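/- In the hyperbolic plane $\mathbb{H}^2$ (hyperboloid model), a convex body is a compact convex set with nonempty interior. If a line $L$ supports a convex body $C$, let $\operatorname{width}_L(C)$ be the distance between $L$ and a farthest line that is ultraparallel to $L$ and supports $C$ (two lines are ultraparallel if they have neither a point nor an ideal point in common). The thickness $\Delta(C)$ is the infimum of $\operatorname{width}_L(C)$ over all lines $L$ supporting $C$. A convex body $R$ is reduced if $\Delta(Z)<\Delta(R)$ for every convex body $Z$ properly contained in $R$. A triangle is the convex hull of three points none of which lies in the convex hull (the segment) of the other two; it is regular if it is the convex hull of three different points $v_1,v_2,v_3$ lying on a hyperbolic circle with $|v_1v_2|=|v_2v_3|=|v_3v_1|$. The only reduced hyperbolic triangles are the regular ones: a triangle $T\subset\mathbb{H}^2$ is reduced if and only if it is regular. -/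

import Mathlib

noncomputable section

namespace Hyperbolic

/-- The Minkowski bilinear form of signature `(2, 1)` on `ℝ³`. -/
def mink (x y : Fin 3 → ℝ) : ℝ := x 0 * y 0 + x 1 * y 1 - x 2 * y 2

/-- The hyperbolic plane in the hyperboloid model: the upper sheet
`x₃ = √(x₁² + x₂² + 1)` of the two-sheeted hyperboloid `x₁² + x₂² - x₃² = -1`. -/
def Plane : Type := {x : Fin 3 → ℝ // mink x x = -1 ∧ 0 < x 2}

/-- The point as a vector of `ℝ³`. -/
def Plane.vec (p : Plane) : Fin 3 → ℝ := p.1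

/-- The topology of the hyperbolic plane (as a subspace of `ℝ³`). -/
instance : TopologicalSpace Plane := instTopologicalSpaceSubtype

/-- The hyperbolic distance `|pq|`, given by `cosh |pq| = -⟨p, q⟩`. -/
def hdist (p q : Plane) : ℝ := Real.arcosh (-mink p.vec q.vec)

/-- The geodesic segment `pq`: the part of the hyperboloid in the cone spanned by `p` and `q`. -/
def hsegment (p q : Plane) : Set Plane :=
  {x | ∃ a b : ℝ, 0 ≤ a ∧ 0 ≤ b ∧ x.vec = a • p.vec + b • q.vec}

/-- A set is convex if it contains the segment between any two of its points. -/
def IsConvex (C : Set Plane) : Prop := ∀ p ∈ C, ∀ q ∈ C, hsegment p q ⊆ C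

/-- The convex hull: the smallest convex set containing the given one. -/
def hull (S : Set Plane) : Set Plane := ⋂₀ {C | IsConvex C ∧ S ⊆ C}

/-- A convex body: a compact convex set with nonempty interior. -/
def IsConvexBody (C : Set Plane) : Prop := IsCompact C ∧ IsConvex C ∧ (interior C).Nonempty

/-- The intersection of the hyperbolic plane with the linear plane Minkowski-orthogonal to `n`.
If `n` is spacelike, `0 < ⟨n, n⟩`, this is a straight line, and every line is of this form. -/
def line (n : Fin 3 → ℝ) : Set Plane := {x | mink x.vec n = 0}

/-- The line `L` supports `C`: it meets `C`, and `C` lies in one of the two closed half-planes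
bounded by `L`. -/
def Supports (L C : Set Plane) : Prop :=
  ∃ n, 0 < mink n n ∧ L = line n ∧ (L ∩ C).Nonempty ∧ ∀ x ∈ C, 0 ≤ mink x.vec n

/-- Two lines are ultraparallel if they have neither a point nor an ideal point in common: the
linear planes spanning them share no timelike vector (a common point) and no nonzero lightlike
vector (a common ideal point). -/
def Ultraparallel (L M : Set Plane) : Prop :=
  ∃ n m, 0 < mink n n ∧ 0 < mink m m ∧ L = line n ∧ M = line m ∧
    ∀ u : Fin 3 → ℝ, u ≠ 0 → mink u n = 0 → mink u m = 0 → 0 < mink u u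

/-- The distance between two sets. -/
def setDist (A B : Set Plane) : ℝ := sInf {d | ∃ x ∈ A, ∃ y ∈ B, d = hdist x y}

/-- `width_L(C)`: the distance between the line `L` supporting `C` and a farthest
line ultraparallel to `L` and supporting `C`. -/
def width (L C : Set Plane) : ℝ :=
  sSup {w | ∃ M, Ultraparallel L M ∧ Supports M C ∧ w = setDist L M}

/-- The thickness `Δ(C)`: the infimum of `width_L(C)` over all lines `L` supporting `C`. -/
def thickness (C : Set Plane) : ℝ := sInf {w | ∃ L, Supports L C ∧ w = width L C}

/-- A convex body `R` is reduced if every convex body properly contained in it has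
smaller thickness. -/
def IsReduced (R : Set Plane) : Prop :=
  IsConvexBody R ∧ ∀ Z, IsConvexBody Z → Z ⊂ R → thickness Z < thickness R

/-- A convex `k`-gon: the convex hull of `k ≥ 3` points none of which is in the convex hull of
the remaining ones. -/
def IsConvexPolygon (k : ℕ) (V : Set Plane) : Prop :=
  3 ≤ k ∧ ∃ v : Fin k → Plane, (∀ i, v i ∉ hull (v '' {j | j ≠ i})) ∧ V = hull (Set.range v)

/-- A regular `k`-gon: the convex hull of `k ≥ 3` (different) points `v₁, …, v_k` on a circle
such that `|v₁v₂| = … = |v_{k-1}v_k| = |v_kv₁|`. -/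
def IsRegularPolygon (k : ℕ) (V : Set Plane) : Prop :=
  3 ≤ k ∧ ∃ v : Fin k → Plane, Function.Injective v ∧
    (∃ (o : Plane) (r : ℝ), ∀ i, hdist o (v i) = r) ∧
    (∀ i j, hdist (v i) (v (finRotate k i)) = hdist (v j) (v (finRotate k j))) ∧
    V = hull (Set.range v)

end Hyperbolic

end

noncomputable section

namespace Hyperbolic

open Real

/-! ### The Minkowski form -/

/-! For a unit normal `n` of a line supporting `C`, with `C` on the nonnegative side, the width is
`arsinh` of the maximum of `⟨x, n⟩` over `C` (`setDist_le_of_supports`, `arsinh_le_width`). So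
thickness bounds become bounds on linear functionals.

For a triangle, `n` is determined by its values `z, x, y` at the vertices, and `vol² ⟨n, n⟩` is an
explicit quadratic form in them (`vol_sq_mul_mink`). The altitude from `A` has hyperbolic sine
`|vol| / √(ch B C ² - 1)`, so the longest side carries the shortest altitude.

Equilateral triangles are reduced: the form shows that every supporting line has a vertex at least
one altitude away. A smaller convex body misses a vertex `A`; pushing the side `BC` towards `A`
until it touches the body gives a supporting line of strictly smaller width
(`thickness_lt_of_notMem`).

Other triangles are not: let `BC` be a shortest side and `AC` a longest, strictly longer one. The
thickness is at most the altitude from `B`, while the altitude from `A` is strictly greater, so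
there is room to cut off a small corner at `A`. The form, bounded by its values at extreme
configurations, shows that the remaining body still has width at least the altitude from `B` in
every direction (`SmallCut.dualForm_le`, `le_thickness_cutTri`). -/

lemma mink_comm (x y : Fin 3 → ℝ) : mink x y = mink y x := by
  simp only [mink]; ring

lemma mink_add_left (x y z : Fin 3 → ℝ) : mink (x + y) z = mink x z + mink y z := by
  simp only [mink, Pi.add_apply]; ring

lemma mink_smul_left (a : ℝ) (x z : Fin 3 → ℝ) : mink (a • x) z = a * mink x z := by
  simp only [mink, Pi.smul_apply, smul_eq_mul]; ring

lemma mink_sub_left (x y z : Fin 3 → ℝ) : mink (x - y) z = mink x z - mink y z := by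
  simp only [mink, Pi.sub_apply]; ring

lemma mink_neg_left (x z : Fin 3 → ℝ) : mink (-x) z = -mink x z := by
  simp only [mink, Pi.neg_apply]; ring

lemma mink_add_right (x y z : Fin 3 → ℝ) : mink z (x + y) = mink z x + mink z y := by
  simp only [mink, Pi.add_apply]; ring

lemma mink_smul_right (a : ℝ) (x z : Fin 3 → ℝ) : mink z (a • x) = a * mink z x := by
  simp only [mink, Pi.smul_apply, smul_eq_mul]; ring

lemma mink_sub_right (x y z : Fin 3 → ℝ) : mink z (x - y) = mink z x - mink z y := by
  simp only [mink, Pi.sub_apply]; ring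

lemma mink_neg_right (x z : Fin 3 → ℝ) : mink z (-x) = -mink z x := by
  simp only [mink, Pi.neg_apply]; ring

lemma Plane.mink_self (p : Plane) : mink p.vec p.vec = -1 := p.2.1

lemma Plane.vec_pos (p : Plane) : 0 < p.vec 2 := p.2.2

lemma Plane.ext_vec {p q : Plane} (h : p.vec = q.vec) : p = q := Subtype.ext h

/-- The bracket on the left is the square of `w + ⟨p, w⟩ p`, the projection of `w` to the orthogonal
complement of `p`; the sum of squares exhibits the form as positive there. -/
lemma Plane.sq_mul_mink_add_sq (p : Plane) (w : Fin 3 → ℝ) :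
    (p.vec 2) ^ 2 * (mink w w + mink p.vec w ^ 2) =
      (w 0 + mink p.vec w * p.vec 0) ^ 2 + (w 1 + mink p.vec w * p.vec 1) ^ 2 +
        (p.vec 0 * w 1 - p.vec 1 * w 0) ^ 2 := by
  have h := p.mink_self
  simp only [mink] at h ⊢
  have h2 : p.vec 2 ^ 2 = 1 + p.vec 0 ^ 2 + p.vec 1 ^ 2 := by linarith
  generalize p.vec 0 = a at *
  generalize p.vec 1 = b at *
  generalize p.vec 2 = c at *
  linear_combination ((a * w 0 + b * w 1 - c * w 2) ^ 2 + w 0 ^ 2 + w 1 ^ 2) * h2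

/-- The reverse Cauchy-Schwarz inequality. -/
lemma Plane.neg_mink_le_sq (p : Plane) (w : Fin 3 → ℝ) : -mink w w ≤ mink p.vec w ^ 2 := by
  have h := p.sq_mul_mink_add_sq w
  have h0 : 0 ≤ (p.vec 2) ^ 2 * (mink w w + mink p.vec w ^ 2) := by rw [h]; positivity
  have := nonneg_of_mul_nonneg_right h0 (by have := p.vec_pos; positivity)
  linarith

lemma Plane.mink_pos_of_orthogonal (p : Plane) {w : Fin 3 → ℝ} (hw : w ≠ 0)
    (h : mink p.vec w = 0) : 0 < mink w w := by
  have hp := p.vec_pos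
  have h1 := p.sq_mul_mink_add_sq w
  rw [h] at h1
  have h2 := p.neg_mink_le_sq w
  rw [h] at h2
  rcases eq_or_lt_of_le (show 0 ≤ mink w w by linarith) with h0 | h0
  · exfalso
    rw [← h0] at h1
    have e0 : w 0 = 0 := by nlinarith [sq_nonneg (w 0), sq_nonneg (w 1), sq_nonneg (p.vec 0 * w 1 - p.vec 1 * w 0)]
    have e1 : w 1 = 0 := by nlinarith [sq_nonneg (w 0), sq_nonneg (w 1), sq_nonneg (p.vec 0 * w 1 - p.vec 1 * w 0)]
    have e2 : w 2 = 0 := by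
      simp only [mink, e0, e1] at h
      have : p.vec 2 * w 2 = 0 := by linarith
      rcases mul_eq_zero.1 this with h' | h'
      · linarith
      · exact h'
    apply hw
    ext i
    fin_cases i <;> simp [e0, e1, e2]
  · exact h0

lemma Plane.pos_of_mink_neg (p : Plane) {u : Fin 3 → ℝ} (hu : mink u u < 0)
    (h : mink p.vec u < 0) : 0 < u 2 := by
  by_contra! hn
  have hp := p.mink_self
  have hc := p.vec_pos
  simp only [mink] at hu h hp
  have h1 : (p.vec 0 * u 0 + p.vec 1 * u 1) ^ 2 ≤ (p.vec 2 * u 2) ^ 2 := by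
    have e1 : (p.vec 0 * u 0 + p.vec 1 * u 1) ^ 2 ≤
        (p.vec 0 ^ 2 + p.vec 1 ^ 2) * (u 0 ^ 2 + u 1 ^ 2) := by
      nlinarith [sq_nonneg (p.vec 0 * u 1 - p.vec 1 * u 0)]
    have e2 : (p.vec 0 ^ 2 + p.vec 1 ^ 2) * (u 0 ^ 2 + u 1 ^ 2) ≤ p.vec 2 ^ 2 * u 2 ^ 2 := by
      apply mul_le_mul <;> first | positivity | nlinarith
    rw [mul_pow]; linarith
  have h2 := abs_le_of_sq_le_sq' (a := p.vec 0 * u 0 + p.vec 1 * u 1) (b := -(p.vec 2 * u 2))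
    (by rw [neg_sq]; exact h1) (by nlinarith)
  linarith [h2.1]

lemma Plane.mink_le_neg_one (p q : Plane) : mink p.vec q.vec ≤ -1 := by
  have h1 := p.neg_mink_le_sq q.vec
  rw [q.mink_self] at h1
  by_contra! h
  have h0 : 1 ≤ mink p.vec q.vec := by nlinarith
  have := p.pos_of_mink_neg (u := -q.vec)
    (by rw [mink_neg_left, mink_neg_right, q.mink_self]; norm_num)
    (by rw [mink_neg_right]; linarith)
  have := q.vec_pos
  simp only [Pi.neg_apply] at *
  linarith

lemma Plane.eq_of_mink_eq {p q : Plane} (h : mink p.vec q.vec = -1) : p = q := by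
  apply Plane.ext_vec
  by_contra hne
  have := p.mink_pos_of_orthogonal (sub_ne_zero.2 hne)
    (by rw [mink_sub_right, h, p.mink_self]; norm_num)
  rw [mink_sub_left, mink_sub_right, mink_sub_right, p.mink_self, q.mink_self,
    mink_comm q.vec, h] at this
  norm_num at this

/-- Every future-directed timelike vector is a positive multiple of a point. -/
lemma exists_plane_smul {u : Fin 3 → ℝ} (hu : mink u u < 0) (h2 : 0 < u 2) :
    ∃ p : Plane, p.vec = (√(-mink u u))⁻¹ • u := by
  have h : 0 < √(-mink u u) := Real.sqrt_pos.2 (by linarith)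
  refine ⟨⟨(√(-mink u u))⁻¹ • u, ?_, ?_⟩, rfl⟩
  · rw [mink_smul_left, mink_smul_right, ← mul_assoc, ← mul_inv,
      Real.mul_self_sqrt (by linarith)]
    have : mink u u ≠ 0 := hu.ne
    field_simp
  · simp only [Pi.smul_apply, smul_eq_mul]; positivity

/-! ### Distances, widths and thickness -/

lemma hdist_nonneg (p q : Plane) : 0 ≤ hdist p q :=
  Real.arcosh_nonneg (by linarith [p.mink_le_neg_one q])

lemma setDist_nonneg (A B : Set Plane) : 0 ≤ setDist A B := by
  apply Real.sInf_nonneg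
  rintro _ ⟨x, -, y, -, rfl⟩
  exact hdist_nonneg x y

lemma setDist_le {A B : Set Plane} {x y : Plane} (hx : x ∈ A) (hy : y ∈ B) :
    setDist A B ≤ hdist x y := by
  refine csInf_le ⟨0, ?_⟩ ⟨x, hx, y, hy, rfl⟩
  rintro _ ⟨x, -, y, -, rfl⟩
  exact hdist_nonneg x y

lemma width_nonneg (L C : Set Plane) : 0 ≤ width L C := by
  apply Real.sSup_nonneg
  rintro _ ⟨M, -, -, rfl⟩
  exact setDist_nonneg L M

/-- The perpendicular from a point to a line. -/
lemma exists_foot {n : Fin 3 → ℝ} (hn : mink n n = 1) (y : Plane) (hy : 0 ≤ mink y.vec n) :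
    ∃ f ∈ line n, hdist f y = arsinh (mink y.vec n) := by
  set t := mink y.vec n with ht
  set u := y.vec - t • n with hu
  have huu : mink u u = -(1 + t ^ 2) := by
    simp only [hu, mink_sub_left, mink_sub_right, mink_smul_left, mink_smul_right,
      mink_comm n y.vec, ← ht, hn, y.mink_self]; ring
  have hyu : mink u y.vec = -(1 + t ^ 2) := by
    simp only [hu, mink_sub_left, mink_smul_left, mink_comm n y.vec, ← ht, y.mink_self]; ring
  have hun : mink u n = 0 := by
    simp only [hu, mink_sub_left, mink_smul_left, ← ht, hn]; ring
  have hneg : mink u u < 0 := by rw [huu]; nlinarith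
  obtain ⟨f, hf⟩ := exists_plane_smul hneg
    (y.pos_of_mink_neg hneg (by rw [mink_comm, hyu]; nlinarith))
  refine ⟨f, ?_, ?_⟩
  · simp only [line, Set.mem_ofPred_eq, hf, mink_smul_left, hun, mul_zero]
  · have : -mink f.vec y.vec = cosh (arsinh t) := by
      rw [hf, mink_smul_left, hyu, huu, neg_neg, cosh_arsinh]
      have h1 : 0 < 1 + t ^ 2 := by positivity
      have h2 : 0 < √(1 + t ^ 2) := Real.sqrt_pos.2 h1
      field_simp
      rw [Real.sq_sqrt h1.le]
    rw [hdist, this, Real.arcosh_cosh (Real.arsinh_nonneg_iff.2 hy)]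

lemma exists_unit_normal {n : Fin 3 → ℝ} (hn : 0 < mink n n) :
    mink ((√(mink n n))⁻¹ • n) ((√(mink n n))⁻¹ • n) = 1 ∧
      line ((√(mink n n))⁻¹ • n) = line n := by
  have h : 0 < √(mink n n) := Real.sqrt_pos.2 hn
  constructor
  · rw [mink_smul_left, mink_smul_right, ← mul_assoc, ← mul_inv, Real.mul_self_sqrt hn.le]
    field_simp
  · ext x
    simp [line, mink_smul_right, h.ne']

lemma Supports.exists_unit {L C : Set Plane} (h : Supports L C) :
    ∃ n, mink n n = 1 ∧ L = line n ∧ (∃ x ∈ C, mink x.vec n = 0) ∧ ∀ x ∈ C, 0 ≤ mink x.vec n := by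
  obtain ⟨n, hn, rfl, ⟨x, hx, hxC⟩, hpos⟩ := h
  have hs : 0 < √(mink n n) := Real.sqrt_pos.2 hn
  have := exists_unit_normal hn
  refine ⟨_, this.1, this.2.symm, ⟨x, hxC, ?_⟩, fun y hy => ?_⟩
  · rw [mink_smul_right, show mink x.vec n = 0 from hx, mul_zero]
  · rw [mink_smul_right]
    have := hpos y hy
    positivity

/-- A supporting line touches `C` at some point, and the perpendicular from that point to the other
line bounds the distance. -/
lemma setDist_le_of_supports {n : Fin 3 → ℝ} (hn : mink n n = 1) {C M : Set Plane}
    (hpos : ∀ x ∈ C, 0 ≤ mink x.vec n) {s : ℝ} (hle : ∀ x ∈ C, mink x.vec n ≤ s)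
    (hM : Supports M C) : setDist (line n) M ≤ arsinh s := by
  obtain ⟨-, -, -, ⟨y, hyM, hyC⟩, -⟩ := hM
  obtain ⟨f, hf, hd⟩ := exists_foot hn y (hpos y hyC)
  calc setDist (line n) M ≤ hdist f y := setDist_le hf hyM
    _ = _ := hd
    _ ≤ _ := arsinh_le_arsinh.2 (hle y hyC)

lemma thickness_le_width {L C : Set Plane} (h : Supports L C) : thickness C ≤ width L C := by
  refine csInf_le ⟨0, ?_⟩ ⟨L, h, rfl⟩
  rintro _ ⟨L, -, rfl⟩
  exact width_nonneg L C

/-- Upper bounds come from a single supporting line; `n` need not be normalized. -/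
lemma thickness_le {n : Fin 3 → ℝ} (hn : 0 < mink n n) {C : Set Plane}
    (hmeet : ∃ x ∈ C, mink x.vec n = 0) (hpos : ∀ x ∈ C, 0 ≤ mink x.vec n) {s : ℝ}
    (hle : ∀ x ∈ C, mink x.vec n ≤ s * √(mink n n)) : thickness C ≤ arsinh s := by
  obtain ⟨x, hxC, hx⟩ := hmeet
  have hs : 0 < √(mink n n) := Real.sqrt_pos.2 hn
  have hs0 : 0 ≤ s := by
    have := hle x hxC
    rw [hx] at this
    exact nonneg_of_mul_nonneg_left this hs
  have hS : Supports (line n) C := ⟨n, hn, rfl, ⟨x, hx, hxC⟩, hpos⟩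
  refine (thickness_le_width hS).trans (Real.sSup_le ?_ (arsinh_nonneg_iff.2 hs0))
  rintro _ ⟨M, -, hM, rfl⟩
  obtain ⟨h1, h2⟩ := exists_unit_normal hn
  rw [← h2]
  refine setDist_le_of_supports h1 (fun y hy => ?_) (fun y hy => ?_) hM
  · rw [mink_smul_right]
    have := hpos y hy
    positivity
  · rw [mink_smul_right, inv_mul_le_iff₀ hs, mul_comm]
    exact hle y hy

/-- The line through the point `q` of `C` farthest from the line with unit normal `n`,
orthogonal to the perpendicular from `q` to that line, supports `C`. -/
lemma arsinh_le_width {n : Fin 3 → ℝ} (hn : mink n n = 1) {C : Set Plane}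
    (hmeet : ∃ x ∈ C, mink x.vec n = 0) (hpos : ∀ x ∈ C, 0 ≤ mink x.vec n) {q : Plane}
    (hq : q ∈ C) (hmax : ∀ x ∈ C, mink x.vec n ≤ mink q.vec n) :
    arsinh (mink q.vec n) ≤ width (line n) C := by
  obtain ⟨x₀, hx₀C, hx₀⟩ := hmeet
  set S := mink q.vec n with hS
  rcases eq_or_lt_of_le (hpos q hq) with h0 | h0
  -- If `S = 0`, then `C` lies in the line and the bound is just nonnegativity of the width.
  · rw [hS, ← h0, arsinh_zero]; exact width_nonneg _ _
  rw [← hS] at h0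
  -- The combination of `n` and `q` orthogonal to `q`. On `C`, `⟨x, n⟩ ≤ S` and `⟨x, q⟩ ≤ -1` make
  -- the product with `m` nonnegative.
  set m := -(n + S • q.vec) with hm
  have hxm : ∀ x : Fin 3 → ℝ, mink x m = -(mink x n + S * mink x q.vec) := fun x => by
    rw [hm, mink_neg_right, mink_add_right, mink_smul_right]
  have hmm : 0 < mink m m := by
    rw [hxm, hm, mink_neg_left, mink_neg_left, mink_add_left, mink_add_left, mink_smul_left,
      mink_smul_left, hn, mink_comm n, ← hS, q.mink_self]
    nlinarith
  have hqm : mink q.vec m = 0 := by rw [hxm, ← hS, q.mink_self]; ring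
  have hsup : Supports (line m) C := by
    refine ⟨m, hmm, rfl, ⟨q, hqm, hq⟩, fun x hx => ?_⟩
    rw [hxm]
    nlinarith [hmax x hx, x.mink_le_neg_one q]
  have hult : Ultraparallel (line n) (line m) := by
    refine ⟨n, m, by rw [hn]; norm_num, hmm, rfl, rfl, fun u hu hun hum => ?_⟩
    rw [hxm, hun] at hum
    refine q.mink_pos_of_orthogonal hu ?_
    rw [mink_comm]
    have : S * mink u q.vec = 0 := by linarith
    exact (mul_eq_zero.1 this).resolve_left h0.ne'
  have hdist : arsinh S ≤ setDist (line n) (line m) := by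
    refine le_csInf ⟨_, x₀, hx₀, q, hqm, rfl⟩ ?_
    rintro _ ⟨x, hx, y, hy, rfl⟩
    have hx' : mink x.vec n = 0 := hx
    have hy' : mink y.vec m = 0 := hy
    rw [hxm] at hy'
    have h1 : S ≤ mink y.vec n := by nlinarith [y.mink_le_neg_one q]
    -- Reverse Cauchy-Schwarz for `x` and the projection of `y` along `n` gives `1 + ⟨y, n⟩² ≤ ⟨x,
    -- y⟩²`.
    have h2 := x.neg_mink_le_sq (y.vec - mink y.vec n • n)
    simp only [mink_sub_left, mink_sub_right, mink_smul_left, mink_smul_right, hx', hn,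
      y.mink_self, mink_comm n y.vec] at h2
    have h3 : cosh (arsinh S) ≤ -mink x.vec y.vec := by
      rw [cosh_arsinh]
      apply Real.sqrt_le_iff.2
      constructor
      · linarith [x.mink_le_neg_one y]
      · nlinarith
    rw [Hyperbolic.hdist, ← Real.arcosh_cosh (arsinh_nonneg_iff.2 h0.le)]
    exact (Real.arcosh_le_arcosh (Real.cosh_pos _) (by linarith [x.mink_le_neg_one y])).2 h3
  refine hdist.trans (le_csSup ⟨arsinh S, ?_⟩ ⟨line m, hult, hsup, rfl⟩)
  rintro _ ⟨M, -, hM, rfl⟩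
  exact setDist_le_of_supports hn hpos hmax hM

lemma continuous_mink_vec (n : Fin 3 → ℝ) : Continuous fun x : Plane => mink x.vec n := by
  have h : Continuous Plane.vec := continuous_subtype_val
  unfold mink
  fun_prop

/-- The existence of a supporting line is needed because the infimum of the empty set is `0`. -/
lemma le_thickness {C : Set Plane} (hC : IsCompact C) (hsup : ∃ L, Supports L C) {s : ℝ}
    (h : ∀ n, mink n n = 1 → (∃ x ∈ C, mink x.vec n = 0) → (∀ x ∈ C, 0 ≤ mink x.vec n) →
      ∃ x ∈ C, s ≤ mink x.vec n) : arsinh s ≤ thickness C := by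
  obtain ⟨L, hL⟩ := hsup
  refine le_csInf ⟨_, L, hL, rfl⟩ ?_
  rintro _ ⟨L, hL, rfl⟩
  obtain ⟨n, hn, rfl, hmeet, hpos⟩ := hL.exists_unit
  obtain ⟨q, hq, hmax⟩ := hC.exists_isMaxOn (hmeet.imp fun x hx => hx.1)
    (continuous_mink_vec n).continuousOn
  obtain ⟨x, hx, hsx⟩ := h n hn hmeet hpos
  exact (arsinh_le_arsinh.2 (hsx.trans (hmax hx))).trans
    (arsinh_le_width hn hmeet hpos hq fun x hx => hmax hx)

/-! ### Triangles and dual bases -/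

/-- The Minkowski cross product. -/
def mcross (u v : Fin 3 → ℝ) : Fin 3 → ℝ :=
  ![u 1 * v 2 - u 2 * v 1, u 2 * v 0 - u 0 * v 2, -(u 0 * v 1 - u 1 * v 0)]

/-- The determinant of three points. -/
def vol (A B C : Plane) : ℝ := mink A.vec (mcross B.vec C.vec)

/-- The first vector of the basis Minkowski-dual to `A`, `B`, `C`. -/
def dual (A B C : Plane) : Fin 3 → ℝ := (vol A B C)⁻¹ • mcross B.vec C.vec

/-- `cosh |AB|`. -/
def ch (A B : Plane) : ℝ := -mink A.vec B.vec

/-- The set of points in the cone spanned by `A`, `B`, `C`. -/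
def tri (A B C : Plane) : Set Plane :=
  {x | ∃ a b c : ℝ, 0 ≤ a ∧ 0 ≤ b ∧ 0 ≤ c ∧ x.vec = a • A.vec + b • B.vec + c • C.vec}

lemma one_le_ch (A B : Plane) : 1 ≤ ch A B := by
  have := A.mink_le_neg_one B
  unfold ch; linarith

lemma ch_comm (A B : Plane) : ch A B = ch B A := by rw [ch, ch, mink_comm]

lemma mink_eq_neg_ch (A B : Plane) : mink A.vec B.vec = -ch A B := by rw [ch, neg_neg]

lemma one_lt_ch {A B : Plane} (h : A ≠ B) : 1 < ch A B := by
  refine lt_of_le_of_ne (one_le_ch A B) fun h1 => h (Plane.eq_of_mink_eq ?_)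
  rw [mink_eq_neg_ch, ← h1]

lemma vol_rotate (A B C : Plane) : vol B C A = vol A B C := by
  simp [vol, mink, mcross]; ring

lemma vol_swap (A B C : Plane) : vol A C B = -vol A B C := by
  simp [vol, mink, mcross]; ring

lemma vol_sq (A B C : Plane) :
    vol A B C ^ 2 = 1 + 2 * ch A B * ch A C * ch B C - ch A B ^ 2 - ch A C ^ 2 - ch B C ^ 2 := by
  have h : vol A B C ^ 2 = -(mink A.vec A.vec * mink B.vec B.vec * mink C.vec C.vec
      + 2 * mink A.vec B.vec * mink A.vec C.vec * mink B.vec C.vec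
      - mink A.vec A.vec * mink B.vec C.vec ^ 2 - mink B.vec B.vec * mink A.vec C.vec ^ 2
      - mink C.vec C.vec * mink A.vec B.vec ^ 2) := by
    simp [vol, mink, mcross]; ring
  rw [h, A.mink_self, B.mink_self, C.mink_self, mink_eq_neg_ch, mink_eq_neg_ch, mink_eq_neg_ch]
  ring

/-- The Gram form of the dual basis, up to the factor `vol A B C ^ 2`. -/
def dualForm (p q r z x y : ℝ) : ℝ :=
  z ^ 2 * (r ^ 2 - 1) + x ^ 2 * (q ^ 2 - 1) + y ^ 2 * (p ^ 2 - 1)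
    - 2 * z * x * (q * r - p) - 2 * z * y * (p * r - q) - 2 * x * y * (p * q - r)

/-- The values at the vertices are the coordinates of `n` in the dual basis, whose Gram matrix is
the inverse of that of `A, B, C`; the factor `vol²` clears the determinant. -/
lemma vol_sq_mul_mink (A B C : Plane) (n : Fin 3 → ℝ) :
    vol A B C ^ 2 * mink n n = dualForm (ch A B) (ch A C) (ch B C)
      (mink A.vec n) (mink B.vec n) (mink C.vec n) := by
  have h : vol A B C ^ 2 * mink n n =
      mink A.vec n ^ 2 * (mink B.vec C.vec ^ 2 - mink B.vec B.vec * mink C.vec C.vec)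
      + mink B.vec n ^ 2 * (mink A.vec C.vec ^ 2 - mink A.vec A.vec * mink C.vec C.vec)
      + mink C.vec n ^ 2 * (mink A.vec B.vec ^ 2 - mink A.vec A.vec * mink B.vec B.vec)
      - 2 * mink A.vec n * mink B.vec n *
        (mink A.vec C.vec * mink B.vec C.vec - mink A.vec B.vec * mink C.vec C.vec)
      - 2 * mink A.vec n * mink C.vec n *
        (mink A.vec B.vec * mink B.vec C.vec - mink A.vec C.vec * mink B.vec B.vec)
      - 2 * mink B.vec n * mink C.vec n *
        (mink A.vec B.vec * mink A.vec C.vec - mink B.vec C.vec * mink A.vec A.vec) := by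
    simp [vol, mink, mcross]; ring
  rw [h, A.mink_self, B.mink_self, C.mink_self, mink_eq_neg_ch A B, mink_eq_neg_ch A C,
    mink_eq_neg_ch B C, dualForm]
  ring

section Dual

variable {A B C : Plane}

lemma mink_dual_first (h : vol A B C ≠ 0) : mink A.vec (dual A B C) = 1 := by
  rw [dual, mink_smul_right]
  exact inv_mul_cancel₀ h

lemma mink_dual_second : mink B.vec (dual A B C) = 0 := by
  have : mink B.vec (mcross B.vec C.vec) = 0 := by simp [mink, mcross]; ring
  rw [dual, mink_smul_right, this, mul_zero]

lemma mink_dual_third : mink C.vec (dual A B C) = 0 := by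
  have : mink C.vec (mcross B.vec C.vec) = 0 := by simp [mink, mcross]; ring
  rw [dual, mink_smul_right, this, mul_zero]

lemma eq_sum_dual (h : vol A B C ≠ 0) (x : Fin 3 → ℝ) :
    x = mink x (dual A B C) • A.vec + mink x (dual B C A) • B.vec +
      mink x (dual C A B) • C.vec := by
  simp only [dual, mink_smul_right, vol_rotate B C A, vol_rotate A B C]
  have key : vol A B C • x = mink x (mcross B.vec C.vec) • A.vec +
      mink x (mcross C.vec A.vec) • B.vec + mink x (mcross A.vec B.vec) • C.vec := by
    ext i
    fin_cases i <;> simp [vol, mink, mcross] <;> ring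
  rw [mul_smul, mul_smul, mul_smul, ← smul_add, ← smul_add, ← key, smul_smul,
    inv_mul_cancel₀ h, one_smul]

lemma mink_comb_left (A B C : Plane) (a b c : ℝ) (n : Fin 3 → ℝ) :
    mink (a • A.vec + b • B.vec + c • C.vec) n =
      a * mink A.vec n + b * mink B.vec n + c * mink C.vec n := by
  simp only [mink_add_left, mink_smul_left]

lemma vol_ne_zero_rotate (h : vol A B C ≠ 0) : vol B C A ≠ 0 := by rwa [vol_rotate]

lemma mem_tri_iff (h : vol A B C ≠ 0) {x : Plane} :
    x ∈ tri A B C ↔ 0 ≤ mink x.vec (dual A B C) ∧ 0 ≤ mink x.vec (dual B C A) ∧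
      0 ≤ mink x.vec (dual C A B) := by
  have h1 := vol_ne_zero_rotate h
  have h2 := vol_ne_zero_rotate h1
  constructor
  · rintro ⟨a, b, c, ha, hb, hc, hx⟩
    simp [hx, mink_comb_left, mink_dual_first h, mink_dual_first h1, mink_dual_first h2,
      mink_dual_second, mink_dual_third, ha, hb, hc]
  · rintro ⟨ha, hb, hc⟩
    exact ⟨_, _, _, ha, hb, hc, eq_sum_dual h x.vec⟩

end Dual

/-! ### Triangles as convex hulls and as convex bodies -/

lemma tri_rotate (A B C : Plane) : tri B C A = tri A B C := by
  ext x
  constructor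
  · rintro ⟨a, b, c, ha, hb, hc, hx⟩
    exact ⟨c, a, b, hc, ha, hb, by rw [hx]; abel⟩
  · rintro ⟨a, b, c, ha, hb, hc, hx⟩
    exact ⟨b, c, a, hb, hc, ha, by rw [hx]; abel⟩

lemma tri_swap (A B C : Plane) : tri A C B = tri A B C := by
  ext x
  constructor
  · rintro ⟨a, b, c, ha, hb, hc, hx⟩
    exact ⟨a, c, b, ha, hc, hb, by rw [hx]; abel⟩
  · rintro ⟨a, b, c, ha, hb, hc, hx⟩
    exact ⟨a, c, b, ha, hc, hb, by rw [hx]; abel⟩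

lemma mink_comb_self (A B C : Plane) (a b c : ℝ) :
    mink (a • A.vec + b • B.vec + c • C.vec) (a • A.vec + b • B.vec + c • C.vec) =
      -(a ^ 2 + b ^ 2 + c ^ 2 + 2 * a * b * ch A B + 2 * a * c * ch A C + 2 * b * c * ch B C) := by
  rw [mink_comb_left]
  simp only [mink_add_right, mink_smul_right, A.mink_self, B.mink_self, C.mink_self,
    mink_comm C.vec A.vec, mink_comm C.vec B.vec, mink_comm B.vec A.vec, mink_eq_neg_ch]
  ring

lemma mink_comb_self_neg (A B C : Plane) {a b c : ℝ} (ha : 0 ≤ a) (hb : 0 ≤ b) (hc : 0 ≤ c)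
    (h : 0 < a + b + c) :
    mink (a • A.vec + b • B.vec + c • C.vec) (a • A.vec + b • B.vec + c • C.vec) < 0 := by
  rw [mink_comb_self]
  have h1 := one_le_ch A B
  have h2 := one_le_ch A C
  have h3 := one_le_ch B C
  have e1 : a * b ≤ a * b * ch A B := le_mul_of_one_le_right (by positivity) h1
  have e2 : a * c ≤ a * c * ch A C := le_mul_of_one_le_right (by positivity) h2
  have e3 : b * c ≤ b * c * ch B C := le_mul_of_one_le_right (by positivity) h3
  nlinarith [mul_pos h h]

/-- A nonzero vector of the cone spanned by three points is a positive multiple of a point. -/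
lemma exists_plane_comb (A B C : Plane) {a b c : ℝ} (ha : 0 ≤ a) (hb : 0 ≤ b) (hc : 0 ≤ c)
    (h : 0 < a + b + c) : ∃ P : Plane,
      P.vec = (√(a ^ 2 + b ^ 2 + c ^ 2 + 2 * a * b * ch A B + 2 * a * c * ch A C
        + 2 * b * c * ch B C))⁻¹ • (a • A.vec + b • B.vec + c • C.vec) ∧
      0 < a ^ 2 + b ^ 2 + c ^ 2 + 2 * a * b * ch A B + 2 * a * c * ch A C + 2 * b * c * ch B C := by
  have h1 := mink_comb_self_neg A B C ha hb hc h
  have hpos : 0 < (a • A.vec + b • B.vec + c • C.vec) 2 := by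
    simp only [Pi.add_apply, Pi.smul_apply, smul_eq_mul]
    have hA := A.vec_pos
    have hB := B.vec_pos
    have hC := C.vec_pos
    rcases ha.lt_or_eq with h | rfl
    · positivity
    rcases hb.lt_or_eq with h | rfl
    · positivity
    have : 0 < c := by linarith
    positivity
  obtain ⟨P, hP⟩ := exists_plane_smul h1 hpos
  rw [mink_comb_self, neg_neg] at hP
  rw [mink_comb_self] at h1
  exact ⟨P, hP, by linarith⟩

lemma left_mem_tri (A B C : Plane) : A ∈ tri A B C :=
  ⟨1, 0, 0, by norm_num, le_rfl, le_rfl, by simp⟩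

lemma mid_mem_tri (A B C : Plane) : B ∈ tri A B C :=
  ⟨0, 1, 0, le_rfl, by norm_num, le_rfl, by simp⟩

lemma right_mem_tri (A B C : Plane) : C ∈ tri A B C :=
  ⟨0, 0, 1, le_rfl, le_rfl, by norm_num, by simp⟩

lemma isConvex_tri (A B C : Plane) : IsConvex (tri A B C) := by
  rintro P ⟨a, b, c, ha, hb, hc, hP⟩ Q ⟨a', b', c', ha', hb', hc', hQ⟩ x ⟨s, t, hs, ht, hx⟩
  refine ⟨s * a + t * a', s * b + t * b', s * c + t * c', by positivity, by positivity,
    by positivity, ?_⟩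
  rw [hx, hP, hQ]
  module

lemma isConvex_halfPlane (n : Fin 3 → ℝ) : IsConvex {x | 0 ≤ mink x.vec n} := by
  rintro P hP Q hQ x ⟨s, t, hs, ht, hx⟩
  have hP' : 0 ≤ mink P.vec n := hP
  have hQ' : 0 ≤ mink Q.vec n := hQ
  change 0 ≤ mink x.vec n
  rw [hx, mink_add_left, mink_smul_left, mink_smul_left]
  positivity

lemma hull_subset {S C : Set Plane} (hC : IsConvex C) (h : S ⊆ C) : hull S ⊆ C :=
  Set.sInter_subset_of_mem ⟨hC, h⟩

lemma subset_hull (S : Set Plane) : S ⊆ hull S := Set.subset_sInter fun _ h => h.2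

lemma isConvex_hull (S : Set Plane) : IsConvex (hull S) := fun p hp q hq _ hx C hC =>
  hC.1 p (hp C hC) q (hq C hC) hx

/-- A point of the triangle lies on a segment from `A` to a point of `BC`, so two applications of
convexity suffice. -/
lemma tri_subset {A B C : Plane} {S : Set Plane} (hS : IsConvex S) (hA : A ∈ S) (hB : B ∈ S)
    (hC : C ∈ S) : tri A B C ⊆ S := by
  rintro x ⟨a, b, c, ha, hb, hc, hx⟩
  rcases (add_nonneg hb hc).lt_or_eq with h | h
  · obtain ⟨P, hP, hpos⟩ := exists_plane_comb A B C le_rfl hb hc (by linarith)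
    set k := √(0 ^ 2 + b ^ 2 + c ^ 2 + 2 * 0 * b * ch A B + 2 * 0 * c * ch A C
        + 2 * b * c * ch B C)
    have hk : 0 < k := Real.sqrt_pos.2 hpos
    have hPS : P ∈ S := by
      refine hS B hB C hC ⟨k⁻¹ * b, k⁻¹ * c, by positivity, by positivity, ?_⟩
      rw [hP]; module
    refine hS A hA P hPS ⟨a, k, ha, hk.le, ?_⟩
    rw [hP, smul_smul, mul_inv_cancel₀ hk.ne', hx]
    module
  · obtain rfl : b = 0 := by linarith
    obtain rfl : c = 0 := by linarith
    exact hS A hA A hA ⟨a, 0, ha, le_rfl, by rw [hx]; simp⟩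

lemma hull_range_eq_tri (v : Fin 3 → Plane) : hull (Set.range v) = tri (v 0) (v 1) (v 2) := by
  apply subset_antisymm
  · apply hull_subset (isConvex_tri _ _ _)
    rintro _ ⟨i, rfl⟩
    fin_cases i
    exacts [left_mem_tri _ _ _, mid_mem_tri _ _ _, right_mem_tri _ _ _]
  · exact tri_subset (isConvex_hull _) (subset_hull _ ⟨0, rfl⟩) (subset_hull _ ⟨1, rfl⟩)
      (subset_hull _ ⟨2, rfl⟩)

lemma isClosedEmbedding_vec : Topology.IsClosedEmbedding Plane.vec := by
  have hm : Continuous fun x : Fin 3 → ℝ => mink x x := by unfold mink; fun_prop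
  have : IsClosed {x : Fin 3 → ℝ | mink x x = -1 ∧ 0 < x 2} := by
    have h : {x : Fin 3 → ℝ | mink x x = -1 ∧ 0 < x 2} = {x | mink x x = -1} ∩ {x | 0 ≤ x 2} := by
      ext x
      constructor
      · rintro ⟨h1, h2⟩
        exact ⟨h1, h2.le⟩
      · rintro ⟨h1, h2⟩
        have h1' : mink x x = -1 := h1
        have h2' : 0 ≤ x 2 := h2
        refine ⟨h1, h2'.lt_of_ne fun h0 => ?_⟩
        rw [mink, ← h0] at h1'
        nlinarith [sq_nonneg (x 0), sq_nonneg (x 1)]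
    rw [h]
    exact (isClosed_eq hm continuous_const).inter
      (isClosed_le continuous_const (continuous_apply 2))
  exact this.isClosedEmbedding_subtypeVal

/-- In `⟨x, x⟩ = -1` all cross terms have the same sign as the squares. This confines the
coefficients to a cube, whence compactness. -/
lemma coeff_bounds {A B C x : Plane} {a b c : ℝ} (ha : 0 ≤ a) (hb : 0 ≤ b) (hc : 0 ≤ c)
    (hx : x.vec = a • A.vec + b • B.vec + c • C.vec) : a ^ 2 + b ^ 2 + c ^ 2 ≤ 1 := by
  have h := mink_comb_self A B C a b c
  rw [← hx, x.mink_self] at h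
  have h1 := one_le_ch A B
  have h2 := one_le_ch A C
  have h3 := one_le_ch B C
  have e1 : 0 ≤ a * b * ch A B := by positivity
  have e2 : 0 ≤ a * c * ch A C := by positivity
  have e3 : 0 ≤ b * c * ch B C := by positivity
  linarith

lemma isCompact_tri (A B C : Plane) : IsCompact (tri A B C) := by
  set F : ℝ × ℝ × ℝ → Fin 3 → ℝ := fun t => t.1 • A.vec + t.2.1 • B.vec + t.2.2 • C.vec with hF
  have hFc : Continuous F := by fun_prop
  have hK : IsCompact (F '' (Set.Icc 0 1 ×ˢ Set.Icc 0 1 ×ˢ Set.Icc 0 1)) :=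
    (isCompact_Icc.prod (isCompact_Icc.prod isCompact_Icc)).image hFc
  convert isClosedEmbedding_vec.isCompact_preimage hK using 1
  ext x
  constructor
  · rintro ⟨a, b, c, ha, hb, hc, hx⟩
    have := coeff_bounds ha hb hc hx
    exact ⟨(a, b, c), ⟨⟨ha, by nlinarith⟩, ⟨hb, by nlinarith⟩, ⟨hc, by nlinarith⟩⟩, hx.symm⟩
  · rintro ⟨⟨a, b, c⟩, ⟨⟨ha, -⟩, ⟨hb, -⟩, ⟨hc, -⟩⟩, hx⟩
    exact ⟨a, b, c, ha, hb, hc, hx.symm⟩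

/-- A half-plane containing an interior point of a triangle cuts off a convex body from it. -/
lemma isConvexBody_tri_inter {A B C : Plane} (h : vol A B C ≠ 0) {m : Fin 3 → ℝ}
    (hm : 0 < mink A.vec m + mink B.vec m + mink C.vec m) :
    IsConvexBody (tri A B C ∩ {x | 0 ≤ mink x.vec m}) := by
  refine ⟨(isCompact_tri A B C).inter_right
      (isClosed_le continuous_const (continuous_mink_vec m)), ?_, ?_⟩
  · exact fun p hp q hq x hx => ⟨isConvex_tri A B C p hp.1 q hq.1 hx,
      isConvex_halfPlane m p hp.2 q hq.2 hx⟩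
  · obtain ⟨P, hP, hpos⟩ := exists_plane_comb A B C zero_le_one zero_le_one zero_le_one
      (by norm_num)
    have hopen : ∀ n, IsOpen {x : Plane | 0 < mink x.vec n} := fun n =>
      isOpen_lt continuous_const (continuous_mink_vec n)
    refine ⟨P, mem_interior.2 ⟨{x | 0 < mink x.vec (dual A B C)} ∩ {x | 0 < mink x.vec (dual B C A)}
      ∩ {x | 0 < mink x.vec (dual C A B)} ∩ {x | 0 < mink x.vec m}, ?_,
      (((hopen _).inter (hopen _)).inter (hopen _)).inter (hopen _), ?_⟩⟩
    · rintro x ⟨⟨⟨h1, h2⟩, h3⟩, h4⟩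
      exact ⟨(mem_tri_iff h).2 ⟨le_of_lt h1, le_of_lt h2, le_of_lt h3⟩,
        show 0 ≤ mink x.vec m from le_of_lt h4⟩
    · have hk := inv_pos.2 (Real.sqrt_pos.2 hpos)
      have h1 := vol_ne_zero_rotate h
      have h2 := vol_ne_zero_rotate h1
      have key : ∀ n, 0 < mink A.vec n + mink B.vec n + mink C.vec n → 0 < mink P.vec n := by
        intro n hn
        rw [hP, mink_smul_left, mink_comb_left]
        exact mul_pos hk (by linarith)
      refine ⟨⟨⟨key _ ?_, key _ ?_⟩, key _ ?_⟩, key _ hm⟩ <;>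
      simp [mink_dual_first h, mink_dual_first h1, mink_dual_first h2, mink_dual_second,
        mink_dual_third]

lemma isConvexBody_tri {A B C : Plane} (h : vol A B C ≠ 0) : IsConvexBody (tri A B C) := by
  have := isConvexBody_tri_inter h (m := dual A B C)
    (by rw [mink_dual_first h, mink_dual_second, mink_dual_third]; norm_num)
  have hs : tri A B C ⊆ {x | 0 ≤ mink x.vec (dual A B C)} := fun x hx => ((mem_tri_iff h).1 hx).1
  rwa [Set.inter_eq_left.2 hs] at this

/-! ### Nondegeneracy -/

lemma mem_hsegment_of_relation {A B C : Plane} {a b c : ℝ} (hb : 0 ≤ b) (hc : 0 ≤ c)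
    (hne : ¬(a = 0 ∧ b = 0 ∧ c = 0)) (h : a • A.vec + b • B.vec + c • C.vec = 0) :
    A ∈ hsegment B C := by
  have ha : a < 0 := by
    by_contra! ha
    have h2 := congrFun h 2
    simp only [Pi.add_apply, Pi.smul_apply, smul_eq_mul, Pi.zero_apply] at h2
    have hA := A.vec_pos
    have hB := B.vec_pos
    have hC := C.vec_pos
    have e1 : 0 ≤ a * A.vec 2 := by positivity
    have e2 : 0 ≤ b * B.vec 2 := by positivity
    have e3 : 0 ≤ c * C.vec 2 := by positivity
    refine hne ⟨?_, ?_, ?_⟩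
    · exact (mul_eq_zero.1 (show a * A.vec 2 = 0 by linarith)).resolve_right hA.ne'
    · exact (mul_eq_zero.1 (show b * B.vec 2 = 0 by linarith)).resolve_right hB.ne'
    · exact (mul_eq_zero.1 (show c * C.vec 2 = 0 by linarith)).resolve_right hC.ne'
  refine ⟨b / (-a), c / (-a), div_nonneg hb (by linarith), div_nonneg hc (by linarith), ?_⟩
  have : (-a) • A.vec = b • B.vec + c • C.vec := by
    rw [neg_smul, neg_eq_iff_add_eq_zero, ← add_assoc, h]
  rw [div_eq_inv_mul, div_eq_inv_mul, mul_smul, mul_smul, ← smul_add, ← this, smul_smul,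
    inv_mul_cancel₀ (by linarith), one_smul]

lemma exists_relation_of_vol_eq_zero {A B C : Plane} (h : vol A B C = 0) :
    ∃ a b c : ℝ, ¬(a = 0 ∧ b = 0 ∧ c = 0) ∧ a • A.vec + b • B.vec + c • C.vec = 0 := by
  have hdet : (Matrix.of ![A.vec, B.vec, C.vec]).det = 0 := by
    rw [← h, Matrix.det_fin_three]
    simp [vol, mink, mcross]; ring
  obtain ⟨w, hw, hw0⟩ := Matrix.exists_vecMul_eq_zero_iff.2 hdet
  refine ⟨w 0, w 1, w 2, fun ⟨h0, h1, h2⟩ => hw ?_, ?_⟩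
  · ext i; fin_cases i <;> simp [h0, h1, h2]
  · ext i
    have := congrFun hw0 i
    simpa [Matrix.vecMul, dotProduct, Fin.sum_univ_three] using this

/-- In a linear relation, up to a global sign, two coefficients are nonnegative. Positivity of the
last coordinate makes the third negative, so its point lies on the segment between the others. -/
lemma vol_ne_zero {A B C : Plane} (hA : A ∉ hsegment B C) (hB : B ∉ hsegment C A)
    (hC : C ∉ hsegment A B) : vol A B C ≠ 0 := by
  intro h
  obtain ⟨a, b, c, hne, h⟩ := exists_relation_of_vol_eq_zero h
  have h' : (-a) • A.vec + (-b) • B.vec + (-c) • C.vec = 0 := by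
    rw [← neg_eq_zero, ← h]; module
  have hne' : ¬(-a = 0 ∧ -b = 0 ∧ -c = 0) := by simpa using hne
  have key : ∀ a b c : ℝ, ¬(a = 0 ∧ b = 0 ∧ c = 0) → a • A.vec + b • B.vec + c • C.vec = 0 →
      0 ≤ a → 0 ≤ b → False := fun a b c hne h ha hb =>
    hC (mem_hsegment_of_relation (a := c) ha hb (by tauto) (by rw [← h]; abel))
  have key2 : ∀ a b c : ℝ, ¬(a = 0 ∧ b = 0 ∧ c = 0) → a • A.vec + b • B.vec + c • C.vec = 0 →
      0 ≤ b → 0 ≤ c → False := fun a b c hne h hb hc =>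
    hA (mem_hsegment_of_relation (a := a) hb hc (by tauto) h)
  have key3 : ∀ a b c : ℝ, ¬(a = 0 ∧ b = 0 ∧ c = 0) → a • A.vec + b • B.vec + c • C.vec = 0 →
      0 ≤ c → 0 ≤ a → False := fun a b c hne h hc ha =>
    hB (mem_hsegment_of_relation (a := b) hc ha (by tauto) (by rw [← h]; abel))
  rcases le_total 0 a with ha | ha <;> rcases le_total 0 b with hb | hb <;>
    rcases le_total 0 c with hc | hc
  · exact key _ _ _ hne h ha hb
  · exact key _ _ _ hne h ha hb
  · exact key3 _ _ _ hne h hc ha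
  · exact key2 _ _ _ hne' h' (by linarith) (by linarith)
  · exact key2 _ _ _ hne h hb hc
  · exact key3 _ _ _ hne' h' (by linarith) (by linarith)
  · exact key _ _ _ hne' h' (by linarith) (by linarith)
  · exact key _ _ _ hne' h' (by linarith) (by linarith)

/-! ### Equilateral triangles are reduced -/

/-- With one value zero and the others `u ≤ v`, replacing `u²` by `u v` leaves `v² (p² - 1) - u v (p
- 1)²`. -/
lemma dualForm_self_le {p z x y M : ℝ} (hp : 1 ≤ p) (hz : 0 ≤ z) (hx : 0 ≤ x) (hy : 0 ≤ y)
    (h0 : z = 0 ∨ x = 0 ∨ y = 0) (hzM : z ≤ M) (hxM : x ≤ M) (hyM : y ≤ M) :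
    dualForm p p p z x y ≤ (p ^ 2 - 1) * M ^ 2 := by
  have key : ∀ u v : ℝ, 0 ≤ u → 0 ≤ v → u ≤ M → v ≤ M →
      u ^ 2 * (p ^ 2 - 1) + v ^ 2 * (p ^ 2 - 1) - 2 * u * v * (p * p - p) ≤
        (p ^ 2 - 1) * M ^ 2 := by
    have aux : ∀ u v : ℝ, 0 ≤ u → u ≤ v → v ≤ M →
      u ^ 2 * (p ^ 2 - 1) + v ^ 2 * (p ^ 2 - 1) - 2 * u * v * (p * p - p) ≤
        (p ^ 2 - 1) * M ^ 2 := by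
      intro u v hu huv hv
      have h1 : 0 ≤ p ^ 2 - 1 := by nlinarith
      have h2 : v ^ 2 * (p ^ 2 - 1) ≤ M ^ 2 * (p ^ 2 - 1) :=
        mul_le_mul_of_nonneg_right (pow_le_pow_left₀ (hu.trans huv) hv 2) h1
      have h3 : u * u * (p ^ 2 - 1) ≤ u * v * (p ^ 2 - 1) :=
        mul_le_mul_of_nonneg_right (mul_le_mul_of_nonneg_left huv hu) h1
      have h4 : 0 ≤ u * v * (p - 1) ^ 2 :=
        mul_nonneg (mul_nonneg hu (hu.trans huv)) (sq_nonneg _)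
      nlinarith
    intro u v hu hv huM hvM
    rcases le_total u v with h | h
    · exact aux u v hu h hvM
    · have := aux v u hv h huM
      linarith
  unfold dualForm
  rcases h0 with rfl | rfl | rfl
  · have := key x y hx hy hxM hyM
    linarith
  · have := key z y hz hy hzM hyM
    linarith
  · have := key z x hz hx hzM hxM
    linarith

/-- A point of a triangle on a supporting line forces a vertex onto that line. -/
lemma exists_vertex_eq_zero {A B C x : Plane} {n : Fin 3 → ℝ} (hx : x ∈ tri A B C)
    (h0 : mink x.vec n = 0) (hA : 0 ≤ mink A.vec n) (hB : 0 ≤ mink B.vec n)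
    (hC : 0 ≤ mink C.vec n) : mink A.vec n = 0 ∨ mink B.vec n = 0 ∨ mink C.vec n = 0 := by
  by_contra! h
  obtain ⟨a, b, c, ha, hb, hc, hx⟩ := hx
  have hA' := hA.lt_of_ne h.1.symm
  have hB' := hB.lt_of_ne h.2.1.symm
  have hC' := hC.lt_of_ne h.2.2.symm
  rw [hx, mink_comb_left] at h0
  have e1 : 0 ≤ a * mink A.vec n := by positivity
  have e2 : 0 ≤ b * mink B.vec n := by positivity
  have e3 : 0 ≤ c * mink C.vec n := by positivity
  have a0 := (mul_eq_zero.1 (show a * mink A.vec n = 0 by linarith)).resolve_right hA'.ne'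
  have b0 := (mul_eq_zero.1 (show b * mink B.vec n = 0 by linarith)).resolve_right hB'.ne'
  have c0 := (mul_eq_zero.1 (show c * mink C.vec n = 0 by linarith)).resolve_right hC'.ne'
  have := x.mink_self
  rw [hx, a0, b0, c0] at this
  simp [mink] at this

section

variable {A B C : Plane}

lemma vol_sq_mul_mink_dual (h : vol A B C ≠ 0) :
    vol A B C ^ 2 * mink (dual A B C) (dual A B C) = ch B C ^ 2 - 1 := by
  rw [vol_sq_mul_mink, mink_dual_first h, mink_dual_second, mink_dual_third, dualForm]
  ring

lemma one_lt_ch_of_vol (h : vol A B C ≠ 0) : 1 < ch B C := by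
  refine one_lt_ch fun hBC => h ?_
  simp [vol, hBC, mink, mcross]; ring

lemma mink_dual_pos (h : vol A B C ≠ 0) : 0 < mink (dual A B C) (dual A B C) := by
  have h1 := vol_sq_mul_mink_dual h
  have h2 := one_lt_ch_of_vol h
  have h3 : 0 < vol A B C ^ 2 := by positivity
  by_contra! h4
  nlinarith

lemma supports_side (h : vol A B C ≠ 0) {S : Set Plane} (hS : S ⊆ tri A B C) (hB : B ∈ S) :
    Supports (line (dual A B C)) S :=
  ⟨_, mink_dual_pos h, rfl, ⟨B, mink_dual_second, hB⟩, fun _ hx => ((mem_tri_iff h).1 (hS hx)).1⟩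

/-- The altitude of the triangle `ABC` from `A`, as the hyperbolic sine of its length. -/
def sinhAltitude (A B C : Plane) : ℝ := |vol A B C| / √(ch B C ^ 2 - 1)

lemma sinhAltitude_pos (h : vol A B C ≠ 0) : 0 < sinhAltitude A B C := by
  have h2 := one_lt_ch_of_vol h
  exact div_pos (abs_pos.2 h) (Real.sqrt_pos.2 (by nlinarith))

lemma sinhAltitude_le {M : ℝ} (h : vol A B C ≠ 0) (hM : 0 ≤ M)
    (h1 : vol A B C ^ 2 ≤ (ch B C ^ 2 - 1) * M ^ 2) : sinhAltitude A B C ≤ M := by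
  have h2 := one_lt_ch_of_vol h
  have h3 : 0 < ch B C ^ 2 - 1 := by nlinarith
  rw [sinhAltitude, div_le_iff₀ (Real.sqrt_pos.2 h3)]
  apply abs_le_of_sq_le_sq _ (by positivity)
  rw [mul_pow, Real.sq_sqrt h3.le]
  linarith

/-- The hypothesis says that `n` is at least as long as `dual A B C`, whose length is the reciprocal
of the altitude's hyperbolic sine. -/
lemma one_le_sinhAltitude_mul {n : Fin 3 → ℝ} (h : vol A B C ≠ 0)
    (h1 : ch B C ^ 2 - 1 ≤ vol A B C ^ 2 * mink n n) :
    1 ≤ sinhAltitude A B C * √(mink n n) := by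
  have h2 := one_lt_ch_of_vol h
  have h3 : 0 < √(ch B C ^ 2 - 1) := Real.sqrt_pos.2 (by nlinarith)
  rw [sinhAltitude, div_mul_eq_mul_div, le_div_iff₀ h3, one_mul, ← Real.sqrt_sq_eq_abs,
    ← Real.sqrt_mul (sq_nonneg _)]
  exact Real.sqrt_le_sqrt h1

lemma le_thickness_equilateral (h : vol A B C ≠ 0) (h1 : ch A B = ch B C) (h2 : ch A C = ch B C) :
    arsinh (sinhAltitude A B C) ≤ thickness (tri A B C) := by
  refine le_thickness (isCompact_tri A B C)
    ⟨_, supports_side h subset_rfl (mid_mem_tri A B C)⟩ fun n hn ⟨x, hx, hx0⟩ hpos => ?_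
  have hA := hpos A (left_mem_tri A B C)
  have hB := hpos B (mid_mem_tri A B C)
  have hC := hpos C (right_mem_tri A B C)
  have h0 := exists_vertex_eq_zero hx hx0 hA hB hC
  have hq := vol_sq_mul_mink A B C n
  rw [hn, mul_one, h1, h2] at hq
  have hle := sinhAltitude_le (M := max (mink A.vec n) (max (mink B.vec n) (mink C.vec n))) h
    (le_max_of_le_left hA) (hq.trans_le (dualForm_self_le (one_le_ch B C) hA hB hC h0
      (le_max_left _ _) (le_max_of_le_right (le_max_left _ _))
      (le_max_of_le_right (le_max_right _ _))))
  rcases le_max_iff.1 hle with h | h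
  · exact ⟨A, left_mem_tri A B C, h⟩
  rcases le_max_iff.1 h with h | h
  · exact ⟨B, mid_mem_tri A B C, h⟩
  · exact ⟨C, right_mem_tri A B C, h⟩

lemma mink_dual_lt_one (h : vol A B C ≠ 0) {x : Plane} (hx : x ∈ tri A B C) (hne : x ≠ A) :
    mink x.vec (dual A B C) < 1 := by
  by_contra! h1
  obtain ⟨a, b, c, ha, hb, hc, hx⟩ := hx
  rw [hx, mink_comb_left, mink_dual_first h, mink_dual_second, mink_dual_third] at h1
  have := coeff_bounds ha hb hc hx
  have b0 : b = 0 := by nlinarith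
  have c0 : c = 0 := by nlinarith
  have a1 : a = 1 := by nlinarith
  exact hne (Plane.ext_vec (by rw [hx, a1, b0, c0]; simp))

/-- A convex body in an equilateral triangle that misses a vertex has smaller thickness. -/
lemma thickness_lt_of_notMem (h : vol A B C ≠ 0) (h1 : ch A B = ch B C) (h2 : ch A C = ch B C)
    {Z : Set Plane} (hZ : IsConvexBody Z) (hZT : Z ⊆ tri A B C) (hA : A ∉ Z) :
    thickness Z < thickness (tri A B C) := by
  refine lt_of_lt_of_le ?_ (le_thickness_equilateral h h1 h2)
  have hZne : Z.Nonempty := hZ.2.2.mono interior_subset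
  set β : Fin 3 → ℝ := dual B C A + dual C A B with hβ
  have hα0 : ∀ x ∈ Z, 0 ≤ mink x.vec (dual A B C) := fun x hx => ((mem_tri_iff h).1 (hZT hx)).1
  have hne : ∀ x ∈ Z, x ≠ A := fun x hx hxA => hA (hxA ▸ hx)
  -- In the triangle `β` vanishes only at `A`, which `Z` misses.
  have hβ0 : ∀ x ∈ Z, 0 < mink x.vec β := by
    intro x hx
    have hm := (mem_tri_iff h).1 (hZT hx)
    rw [hβ, mink_add_right]
    refine (add_nonneg hm.2.1 hm.2.2).lt_of_ne fun h0 => ?_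
    have e1 : mink x.vec (dual B C A) = 0 := by linarith [hm.2.1, hm.2.2]
    have e2 : mink x.vec (dual C A B) = 0 := by linarith [hm.2.1, hm.2.2]
    have hv := eq_sum_dual h x.vec
    have hself := x.mink_self
    rw [e1, e2] at hv
    simp only [zero_smul, add_zero] at hv
    have hlt := mink_dual_lt_one h (hZT hx) (hne x hx)
    rw [hv, mink_smul_left, mink_smul_right, A.mink_self] at hself
    nlinarith [hα0 x hx]
  obtain ⟨y, hy, hymin⟩ := hZ.1.exists_isMinOn (f := fun x => mink x.vec (dual A B C) /
    mink x.vec β) hZne ((continuous_mink_vec _).continuousOn.div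
      (continuous_mink_vec _).continuousOn fun x hx => (hβ0 x hx).ne')
  obtain ⟨w, hw, hwmax⟩ := hZ.1.exists_isMaxOn hZne (continuous_mink_vec (dual A B C)).continuousOn
  -- The least ratio over `Z`: the line with normal `dual A B C - t • β` touches `Z` at `y` and has
  -- `Z` on its nonnegative side.
  set t := mink y.vec (dual A B C) / mink y.vec β with ht
  have ht0 : 0 ≤ t := div_nonneg (hα0 y hy) (hβ0 y hy).le
  set n := dual A B C - t • β with hn
  have hxn : ∀ x : Plane, mink x.vec n = mink x.vec (dual A B C) - t * mink x.vec β := fun x => by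
    rw [hn, mink_sub_right, mink_smul_right]
  have hr := one_lt_ch_of_vol h
  have hB1 := vol_ne_zero_rotate h
  have hC1 := vol_ne_zero_rotate hB1
  -- The values at the vertices are `1, -t, -t`. With `r = ch B C`, the form exceeds `r² - 1` by `4
  -- t r (r - 1) + 2 t² (r - 1)`.
  have hnn : ch B C ^ 2 - 1 ≤ vol A B C ^ 2 * mink n n := by
    rw [vol_sq_mul_mink, hxn, hxn, hxn, hβ, mink_add_right, mink_add_right, mink_add_right,
      mink_dual_first h, mink_dual_first hB1, mink_dual_first hC1]
    simp only [mink_dual_second, mink_dual_third, h1, h2, dualForm]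
    have e1 : 0 ≤ t * (ch B C * (ch B C - 1)) :=
      mul_nonneg ht0 (mul_nonneg (by linarith) (by linarith))
    have e2 : 0 ≤ t ^ 2 * (ch B C - 1) := mul_nonneg (sq_nonneg t) (by linarith)
    nlinarith
  have hnpos : 0 < mink n n := by
    by_contra! hle
    nlinarith [sq_nonneg (vol A B C)]
  have hs := sinhAltitude_pos h
  have hone := one_le_sinhAltitude_mul h hnn
  have hw0 := hα0 w hw
  have hw1 := mink_dual_lt_one h (hZT hw) (hne w hw)
  refine lt_of_le_of_lt (thickness_le (s := mink w.vec (dual A B C) * sinhAltitude A B C)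
    hnpos ⟨y, hy, ?_⟩ (fun x hx => ?_) fun x hx => ?_) (arsinh_lt_arsinh.2 (by nlinarith))
  · rw [hxn, ht, div_mul_cancel₀ _ (hβ0 y hy).ne', sub_self]
  · have := hymin hx
    simp only [Set.mem_ofPred_eq] at this
    rw [hxn, sub_nonneg, ← le_div_iff₀ (hβ0 x hx)]
    exact this
  · rw [hxn]
    have e1 : mink x.vec (dual A B C) ≤ mink w.vec (dual A B C) := hwmax hx
    have e2 : 0 ≤ t * mink x.vec β := mul_nonneg ht0 (hβ0 x hx).le
    have e3 := mul_le_mul_of_nonneg_left hone hw0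
    rw [mul_one, ← mul_assoc] at e3
    linarith

lemma isReduced_equilateral (h : vol A B C ≠ 0) (h1 : ch A B = ch B C) (h2 : ch A C = ch B C) :
    IsReduced (tri A B C) := by
  refine ⟨isConvexBody_tri h, fun Z hZ hZT => ?_⟩
  by_cases hA : A ∈ Z
  · by_cases hB : B ∈ Z
    · by_cases hC : C ∈ Z
      · exact absurd (tri_subset hZ.2.1 hA hB hC) hZT.2
      · have hv := vol_ne_zero_rotate (vol_ne_zero_rotate h)
        rw [← tri_rotate A B C, ← tri_rotate B C A] at hZT ⊢
        exact thickness_lt_of_notMem hv (by rw [ch_comm, h2, h1])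
          (by rw [ch_comm C B, h1]) hZ hZT.1 hC
    · have hv := vol_ne_zero_rotate h
      rw [← tri_rotate A B C] at hZT ⊢
      exact thickness_lt_of_notMem hv (by rw [ch_comm C A, h2])
        (by rw [ch_comm C A, ch_comm B A, h1, h2]) hZ hZT.1 hB
  · exact thickness_lt_of_notMem h h1 h2 hZ hZT.1 hA

end

/-! ### Other triangles are not reduced -/

/-- A form that is convex in each variable is bounded on a rectangle by its corner values. -/
lemma biconvex_le {R P S K μ M z x : ℝ} (hR : 0 ≤ R) (hP : 0 ≤ P) (hμ : 0 < μ)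
    (hz : 0 ≤ z) (hzM : z ≤ μ * M) (hx : 0 ≤ x) (hxM : x ≤ M) (hPK : P ≤ K)
    (h1 : μ ^ 2 * R ≤ K) (h2 : μ ^ 2 * R - 2 * μ * S + P ≤ K) :
    z ^ 2 * R + x ^ 2 * P - 2 * z * x * S ≤ K * M ^ 2 := by
  obtain ⟨w, rfl⟩ : ∃ w, z = μ * w := ⟨z / μ, by field_simp⟩
  have hw : 0 ≤ w := nonneg_of_mul_nonneg_right hz hμ
  have hwM : w ≤ M := le_of_mul_le_mul_left hzM hμ
  have hM : 0 ≤ M := hw.trans hwM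
  have hR' : 0 ≤ μ ^ 2 * R := by positivity
  set R' := μ ^ 2 * R
  set S' := μ * S with hS'
  have : (μ * w) ^ 2 * R + x ^ 2 * P - 2 * (μ * w) * x * S = w ^ 2 * R' + x ^ 2 * P
    - 2 * w * x * S' := by simp only [R', S']; ring
  rw [this]
  have h2' : R' - 2 * S' + P ≤ K := by simp only [R', S']; linarith
  have e1 : w ^ 2 * R' ≤ w * M * R' := by
    rw [sq]; exact mul_le_mul_of_nonneg_right (mul_le_mul_of_nonneg_left hwM hw) hR'
  have e2 : x ^ 2 * P ≤ x * M * P := by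
    rw [sq]; exact mul_le_mul_of_nonneg_right (mul_le_mul_of_nonneg_left hxM hx) hP
  -- The weights `w x`, `w (M - x)`, `(M - w) x`, `(M - w)(M - x)` of the four corners add up to
  -- `M²`.
  have f1 : w * x * (R' - 2 * S' + P) ≤ w * x * K := mul_le_mul_of_nonneg_left h2' (by positivity)
  have f2 : w * (M - x) * R' ≤ w * (M - x) * K :=
    mul_le_mul_of_nonneg_left h1 (mul_nonneg hw (by linarith))
  have f3 : (M - w) * x * P ≤ (M - w) * x * K :=
    mul_le_mul_of_nonneg_left hPK (mul_nonneg (by linarith) hx)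
  have f4 : 0 ≤ (M - w) * (M - x) * K :=
    mul_nonneg (mul_nonneg (by linarith) (by linarith)) (hP.trans hPK)
  linarith

/-- How small a corner has to be cut off a triangle. -/
structure SmallCut (p q r κ : ℝ) : Prop where
  pos : 0 < κ
  le_one : κ ≤ 1
  vertex : (1 + κ * q) ^ 2 * (r ^ 2 - 1) ≤ q ^ 2 - 1
  long : (1 + κ * q) * (r ^ 2 - 1) ≤ 2 * (q * r - p)
  short : (1 + κ * q) ^ 2 * (r ^ 2 - 1) - 2 * (1 + κ * q) * (p * r - q) + (p ^ 2 - 1) ≤ q ^ 2 - 1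
  cut : κ ^ 2 * (r ^ 2 - 1) + (p ^ 2 - 1) + 2 * κ * (p * r - q) + 2 * κ * (q * r - p) ≤
    2 * (p * q - r)
  acute : 2 * κ * (q - p * r) ≤ p ^ 2 - 1

lemma eventually_le_nhdsGT {f g : ℝ → ℝ} (hf : Continuous f) (hg : Continuous g) (h : f 0 < g 0) :
    ∀ᶠ κ in nhdsWithin (0 : ℝ) (Set.Ioi 0), f κ ≤ g κ :=
  Filter.Eventually.mono (nhdsWithin_le_nhds ((isOpen_lt hf hg).mem_nhds h)) fun _ h => le_of_lt h

/-- Every inequality other than `κ > 0` is strict at `κ = 0`, so continuity gives a small positive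
`κ`. For `short` the limiting inequality is `(p - r)² < (q - 1)²`. -/
lemma exists_smallCut {p q r : ℝ} (hr : 1 < r) (hrp : r ≤ p) (hpq : p ≤ q) (hrq : r < q) :
    ∃ κ, SmallCut p q r κ := by
  have h1 := eventually_le_nhdsGT (f := fun κ => κ) (g := fun _ => 1) (by fun_prop)
    (by fun_prop) (by norm_num)
  have h2 := eventually_le_nhdsGT (f := fun κ => (1 + κ * q) ^ 2 * (r ^ 2 - 1))
    (g := fun _ => q ^ 2 - 1) (by fun_prop) (by fun_prop) (by nlinarith)
  have h3 := eventually_le_nhdsGT (f := fun κ => (1 + κ * q) * (r ^ 2 - 1))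
    (g := fun _ => 2 * (q * r - p)) (by fun_prop) (by fun_prop)
    (by nlinarith [mul_pos (sub_pos.2 hr) (sub_pos.2 hrq), mul_pos (sub_pos.2 hr) (sub_pos.2 hr)])
  have h4 := eventually_le_nhdsGT (f := fun κ => (1 + κ * q) ^ 2 * (r ^ 2 - 1)
      - 2 * (1 + κ * q) * (p * r - q) + (p ^ 2 - 1))
    (g := fun _ => q ^ 2 - 1) (by fun_prop) (by fun_prop)
    (by nlinarith [mul_pos (show 0 < q - p + (r - 1) by linarith)
          (show 0 < p - r + (q - 1) by linarith)])
  have h5 := eventually_le_nhdsGT (f := fun κ => κ ^ 2 * (r ^ 2 - 1) + (p ^ 2 - 1)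
      + 2 * κ * (p * r - q) + 2 * κ * (q * r - p))
    (g := fun _ => 2 * (p * q - r)) (by fun_prop) (by fun_prop)
    (by nlinarith [mul_pos (show 0 < p - 1 by linarith) (show 0 < p - 1 by linarith),
        mul_nonneg (show 0 ≤ p by linarith) (sub_nonneg.2 hpq)])
  have h6 := eventually_le_nhdsGT (f := fun κ => 2 * κ * (q - p * r))
    (g := fun _ => p ^ 2 - 1) (by fun_prop) (by fun_prop) (by nlinarith)
  obtain ⟨κ, ⟨⟨⟨⟨⟨k1, k2⟩, k3⟩, k4⟩, k5⟩, k6⟩, k0⟩ :=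
    ((((((h1.and h2).and h3).and h4).and h5).and h6).and self_mem_nhdsWithin).exists
  exact ⟨κ, k0, k1, k2, k3, k4, k5, k6⟩

/-- Handles a line through a new vertex with `A` strictly beyond it: then `z = -κ u`, where `u` is
the smaller of the values at `B` and `C`. -/
lemma cut_le {R P Q K T κ s s' u v M : ℝ} (hu : 0 ≤ u) (huv : u ≤ v) (hvM : v ≤ M)
    (hK : 0 ≤ K) (hQ : Q ≤ K) (hL : 0 ≤ κ ^ 2 * R + P + 2 * κ * s)
    (h : κ ^ 2 * R + P + 2 * κ * s + 2 * κ * s' + Q ≤ 2 * T + K) :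
    (κ * u) ^ 2 * R + v ^ 2 * Q + u ^ 2 * P + 2 * (κ * u) * v * s' + 2 * (κ * u) * u * s
      - 2 * u * v * T ≤ K * M ^ 2 := by
  have hv := hu.trans huv
  have e1 : u * u * (κ ^ 2 * R + P + 2 * κ * s) ≤ u * v * (κ ^ 2 * R + P + 2 * κ * s) :=
    mul_le_mul_of_nonneg_right (mul_le_mul_of_nonneg_left huv hu) hL
  have e2 := mul_le_mul_of_nonneg_left h (mul_nonneg hu hv)
  have e3 : u * v * (K - Q) ≤ v * v * (K - Q) :=
    mul_le_mul_of_nonneg_right (mul_le_mul_of_nonneg_right huv hv) (by linarith)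
  have e4 : v ^ 2 * K ≤ M ^ 2 * K := mul_le_mul_of_nonneg_right (pow_le_pow_left₀ hv hvM 2) hK
  linarith

/-- Bound for the width of a triangle with one corner cut off. -/
lemma SmallCut.dualForm_le {p q r κ z x y M : ℝ} (h : SmallCut p q r κ) (hr : 1 < r)
    (hrp : r ≤ p) (hpq : p ≤ q) (hx : 0 ≤ x) (hy : 0 ≤ y) (hzx : 0 ≤ z + κ * x)
    (hzy : 0 ≤ z + κ * y) (h0 : x = 0 ∨ y = 0 ∨ z + κ * x = 0 ∨ z + κ * y = 0)
    (hxM : x ≤ M) (hyM : y ≤ M) (hzxM : z + κ * x ≤ (1 + κ * q) * M)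
    (hzyM : z + κ * y ≤ (1 + κ * q) * M) :
    dualForm p q r z x y ≤ (q ^ 2 - 1) * M ^ 2 := by
  have hκ := h.pos
  have hR : 0 ≤ r ^ 2 - 1 := by nlinarith
  have hP : 0 ≤ p ^ 2 - 1 := by nlinarith
  have hQ : 0 ≤ q ^ 2 - 1 := by nlinarith
  have hPQ : p ^ 2 - 1 ≤ q ^ 2 - 1 := by nlinarith
  have hμ : 0 < 1 + κ * q := by nlinarith
  have hl : (1 + κ * q) ^ 2 * (r ^ 2 - 1) - 2 * (1 + κ * q) * (q * r - p) + (q ^ 2 - 1) ≤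
      q ^ 2 - 1 := by nlinarith [mul_le_mul_of_nonneg_left h.long hμ.le]
  have hqr : 0 ≤ q * r - p := by nlinarith
  -- If `z ≥ 0`, the line may be taken to touch at `B` or `C`, and the form is bounded on a
  -- rectangle. If `z < 0`, it cuts `A` off and touches at a new vertex.
  rcases le_or_gt 0 z with hz | hz
  · have hxy : x = 0 ∨ y = 0 := by
      rcases h0 with h0 | h0 | h0 | h0
      · exact Or.inl h0
      · exact Or.inr h0
      · have : κ * x = 0 := by nlinarith [mul_nonneg hκ.le hx]
        exact Or.inl ((mul_eq_zero.1 this).resolve_left hκ.ne')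
      · have : κ * y = 0 := by nlinarith [mul_nonneg hκ.le hy]
        exact Or.inr ((mul_eq_zero.1 this).resolve_left hκ.ne')
    have hzM : z ≤ (1 + κ * q) * M := by nlinarith [mul_nonneg hκ.le hx]
    rcases hxy with rfl | rfl
    · have := biconvex_le hR hP hμ hz hzM hy hyM hPQ h.vertex h.short
      unfold dualForm
      linarith
    · have := biconvex_le hR hQ hμ hz hzM hx hxM le_rfl h.vertex hl
      unfold dualForm
      linarith
  · have hcases : z + κ * x = 0 ∨ z + κ * y = 0 := by
      rcases h0 with rfl | rfl | h0 | h0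
      · linarith
      · linarith
      · exact Or.inl h0
      · exact Or.inr h0
    have hκR : 0 ≤ κ ^ 2 * (r ^ 2 - 1) := by positivity
    have hcut := h.cut
    have hacute := h.acute
    rcases hcases with h1 | h1
    · have hxy : x ≤ y := le_of_mul_le_mul_left (by linarith) hκ
      have := cut_le (R := r ^ 2 - 1) (P := q ^ 2 - 1) (T := p * q - r) (κ := κ)
        (s := q * r - p) (s' := p * r - q) hx hxy hyM hQ hPQ
        (by have := mul_nonneg hκ.le hqr; linarith) (by linarith)
      obtain rfl : z = -(κ * x) := by linarith
      unfold dualForm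
      linarith
    · have hyx : y ≤ x := le_of_mul_le_mul_left (by linarith) hκ
      have := cut_le (R := r ^ 2 - 1) (P := p ^ 2 - 1) (T := p * q - r) (κ := κ)
        (s := p * r - q) (s' := q * r - p) hy hyx hxM hQ le_rfl (by linarith) (by linarith)
      obtain rfl : z = -(κ * y) := by linarith
      unfold dualForm
      linarith

/-! ### Cutting off the corner opposite a shortest side -/

section

variable {A B C : Plane}

lemma thickness_tri_le (h : vol A B C ≠ 0) :
    thickness (tri A B C) ≤ arsinh (sinhAltitude A B C) := by
  refine thickness_le (mink_dual_pos h) ⟨B, mid_mem_tri A B C, mink_dual_second⟩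
    (fun x hx => ((mem_tri_iff h).1 hx).1) fun x hx => ?_
  refine le_trans ?_ (one_le_sinhAltitude_mul h (vol_sq_mul_mink_dual h).ge)
  by_cases hxA : x = A
  · rw [hxA, mink_dual_first h]
  · exact (mink_dual_lt_one h hx hxA).le

/-- The normal of the line cutting off the corner `A`; it passes through the points proportional
to `A + κ B` and `A + κ C`. -/
def cutNormal (A B C : Plane) (κ : ℝ) : Fin 3 → ℝ :=
  dual B C A + dual C A B - κ • dual A B C

lemma mink_cutNormal_left (h : vol A B C ≠ 0) (κ : ℝ) :
    mink A.vec (cutNormal A B C κ) = -κ := by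
  rw [cutNormal, mink_sub_right, mink_add_right, mink_smul_right, mink_dual_first h,
    mink_dual_second, mink_dual_third]
  ring

lemma mink_cutNormal_mid (h : vol A B C ≠ 0) (κ : ℝ) :
    mink B.vec (cutNormal A B C κ) = 1 := by
  rw [cutNormal, mink_sub_right, mink_add_right, mink_smul_right,
    mink_dual_first (vol_ne_zero_rotate h), mink_dual_second, mink_dual_third]
  ring

lemma mink_cutNormal_right (h : vol A B C ≠ 0) (κ : ℝ) :
    mink C.vec (cutNormal A B C κ) = 1 := by
  rw [cutNormal, mink_sub_right, mink_add_right, mink_smul_right,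
    mink_dual_first (vol_ne_zero_rotate (vol_ne_zero_rotate h)), mink_dual_second,
    mink_dual_third]
  ring

/-- The triangle `ABC` with the corner at `A` cut off. -/
def cutTri (A B C : Plane) (κ : ℝ) : Set Plane :=
  tri A B C ∩ {x | 0 ≤ mink x.vec (cutNormal A B C κ)}

/-- The new vertices are `A + κ B` and `A + κ C` divided by their Minkowski lengths, which are at
most `1 + κ q`; this is the source of that factor in `SmallCut`. -/
lemma exists_cut_vertex (h : vol A B C ≠ 0) {κ q : ℝ} (hκ : 0 < κ) (hB : ch A B ≤ q)
    (hC : ch A C ≤ q) (b c : ℝ) (hbc : b = κ ∧ c = 0 ∨ b = 0 ∧ c = κ) :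
    ∃ P ∈ cutTri A B C κ, ∀ n, (0 ≤ mink P.vec n →
      0 ≤ mink A.vec n + b * mink B.vec n + c * mink C.vec n) ∧
      (∀ M, 0 ≤ M → mink P.vec n ≤ M →
        mink A.vec n + b * mink B.vec n + c * mink C.vec n ≤ (1 + κ * q) * M) := by
  have hb : 0 ≤ b := by rcases hbc with ⟨rfl, -⟩ | ⟨rfl, -⟩ <;> linarith
  have hc : 0 ≤ c := by rcases hbc with ⟨-, rfl⟩ | ⟨-, rfl⟩ <;> linarith
  have hsum : b + c = κ := by rcases hbc with ⟨rfl, rfl⟩ | ⟨rfl, rfl⟩ <;> ring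
  obtain ⟨P, hP, hpos⟩ := exists_plane_comb A B C zero_le_one hb hc (by linarith)
  set S := 1 ^ 2 + b ^ 2 + c ^ 2 + 2 * 1 * b * ch A B + 2 * 1 * c * ch A C + 2 * b * c * ch B C
    with hS
  have hs : 0 < √S := Real.sqrt_pos.2 hpos
  have hPn : ∀ n, mink P.vec n =
      (√S)⁻¹ * (mink A.vec n + b * mink B.vec n + c * mink C.vec n) := fun n => by
    rw [hP, mink_smul_left, mink_comb_left, one_mul]
  have hq := (one_le_ch A B).trans hB
  have hSq : √S ≤ 1 + κ * q := by
    apply Real.sqrt_le_iff.2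
    refine ⟨by nlinarith, ?_⟩
    have e1 : κ * ch A B ≤ κ * q := mul_le_mul_of_nonneg_left hB hκ.le
    have e2 : κ * ch A C ≤ κ * q := mul_le_mul_of_nonneg_left hC hκ.le
    have e3 : κ ^ 2 ≤ κ ^ 2 * q ^ 2 := le_mul_of_one_le_right (sq_nonneg _) (by nlinarith)
    rcases hbc with ⟨rfl, rfl⟩ | ⟨rfl, rfl⟩ <;> rw [hS] <;> nlinarith
  refine ⟨P, ⟨⟨(√S)⁻¹ * 1, (√S)⁻¹ * b, (√S)⁻¹ * c, by positivity, by positivity, by positivity,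
    by rw [hP]; module⟩, ?_⟩, fun n => ⟨fun h0 => ?_, fun M hM h0 => ?_⟩⟩
  · change 0 ≤ mink P.vec _
    rw [hPn, mink_cutNormal_left h, mink_cutNormal_mid h, mink_cutNormal_right h]
    have : -κ + b * 1 + c * 1 = 0 := by linarith
    rw [this, mul_zero]
  · rw [hPn] at h0
    exact nonneg_of_mul_nonneg_right h0 (inv_pos.2 hs)
  · rw [hPn, inv_mul_le_iff₀ hs] at h0
    exact h0.trans (mul_le_mul_of_nonneg_right hSq hM)

lemma le_thickness_cutTri (h : vol A B C ≠ 0) {κ : ℝ} (hr : ch B C ≤ ch A B)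
    (hp : ch A B ≤ ch A C) (hκ : SmallCut (ch A B) (ch A C) (ch B C) κ) :
    arsinh (sinhAltitude B C A) ≤ thickness (cutTri A B C κ) := by
  have hcl : IsCompact (cutTri A B C κ) := (isCompact_tri A B C).inter_right
      (isClosed_le continuous_const (continuous_mink_vec _))
  have hBZ : B ∈ cutTri A B C κ := ⟨mid_mem_tri A B C, by
    change 0 ≤ mink B.vec _; rw [mink_cutNormal_mid h]; norm_num⟩
  have hCZ : C ∈ cutTri A B C κ := ⟨right_mem_tri A B C, by
    change 0 ≤ mink C.vec _; rw [mink_cutNormal_right h]; norm_num⟩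
  refine le_thickness hcl ⟨_, supports_side h Set.inter_subset_left hBZ⟩
    fun n hn ⟨w, hw, hw0⟩ hpos => ?_
  obtain ⟨P, hPZ, hP⟩ := exists_cut_vertex h hκ.pos hp le_rfl κ 0 (Or.inl ⟨rfl, rfl⟩)
  obtain ⟨Q, hQZ, hQ⟩ := exists_cut_vertex h hκ.pos hp le_rfl 0 κ (Or.inr ⟨rfl, rfl⟩)
  have hx := hpos B hBZ
  have hy := hpos C hCZ
  have hzx := (hP n).1 (hpos P hPZ)
  have hzy := (hQ n).1 (hpos Q hQZ)
  have hPM := (hP n).2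
  have hQM := (hQ n).2
  have hq := vol_sq_mul_mink A B C n
  rw [hn, mul_one] at hq
  simp only [zero_mul, add_zero] at hzx hzy hPM hQM
  have hκ0 := hκ.pos
  have h0 : mink B.vec n = 0 ∨ mink C.vec n = 0 ∨ mink A.vec n + κ * mink B.vec n = 0 ∨
      mink A.vec n + κ * mink C.vec n = 0 := by
    by_contra! hne
    have hx' := hx.lt_of_ne hne.1.symm
    have hy' := hy.lt_of_ne hne.2.1.symm
    have hzx' := hzx.lt_of_ne hne.2.2.1.symm
    have hzy' := hzy.lt_of_ne hne.2.2.2.symm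
    obtain ⟨⟨a, b, c, ha, hb, hc, hwv⟩, hwm⟩ := hw
    change 0 ≤ mink w.vec _ at hwm
    rw [hwv, mink_comb_left, mink_cutNormal_left h, mink_cutNormal_mid h,
      mink_cutNormal_right h] at hwm
    rw [hwv, mink_comb_left] at hw0
    -- If `A` is on the negative side, `κ w` is rewritten as a combination of `A + κ B`, `A + κ C`
    -- and a nonpositive multiple of `A`, so that all terms of `κ ⟨w, n⟩ = 0` are nonnegative.
    have hbc : b = 0 ∧ c = 0 := by
      rcases le_or_gt 0 (mink A.vec n) with hz | hz
      · have e1 : 0 ≤ a * mink A.vec n := by positivity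
        have e2 : 0 ≤ b * mink B.vec n := by positivity
        have e3 : 0 ≤ c * mink C.vec n := by positivity
        exact ⟨(mul_eq_zero.1 (show b * mink B.vec n = 0 by linarith)).resolve_right hx'.ne',
          (mul_eq_zero.1 (show c * mink C.vec n = 0 by linarith)).resolve_right hy'.ne'⟩
      · have e1 : 0 ≤ -mink A.vec n * (b + c - κ * a) :=
          mul_nonneg (by linarith) (by linarith)
        have e2 := mul_nonneg hb hzx
        have e3 := mul_nonneg hc hzy
        have e4 : -mink A.vec n * (b + c - κ * a) + b * (mink A.vec n + κ * mink B.vec n)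
            + c * (mink A.vec n + κ * mink C.vec n) = 0 := by linear_combination κ * hw0
        exact ⟨(mul_eq_zero.1 (show b * (mink A.vec n + κ * mink B.vec n) = 0 by
            linarith)).resolve_right hzx'.ne',
          (mul_eq_zero.1 (show c * (mink A.vec n + κ * mink C.vec n) = 0 by
            linarith)).resolve_right hzy'.ne'⟩
    obtain ⟨rfl, rfl⟩ := hbc
    have ha0 : a = 0 := by nlinarith
    have := w.mink_self
    rw [hwv, ha0] at this
    simp [mink] at this
  have h1 := vol_ne_zero_rotate h
  set M := max (max (mink B.vec n) (mink C.vec n)) (max (mink P.vec n) (mink Q.vec n)) with hM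
  have hxM : mink B.vec n ≤ M := le_max_of_le_left (le_max_left _ _)
  have hyM : mink C.vec n ≤ M := le_max_of_le_left (le_max_right _ _)
  have hM0 : 0 ≤ M := hx.trans hxM
  have hle := sinhAltitude_le (M := M) h1 hM0 (by
    rw [vol_rotate, ch_comm C A]
    exact hq.trans_le (hκ.dualForm_le (one_lt_ch_of_vol h) hr hp hx hy hzx hzy h0 hxM hyM
      (hPM M hM0 (le_max_of_le_right (le_max_left _ _)))
      (hQM M hM0 (le_max_of_le_right (le_max_right _ _)))))
  rcases le_max_iff.1 hle with h | h <;> rcases le_max_iff.1 h with h | h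
  exacts [⟨B, hBZ, h⟩, ⟨C, hCZ, h⟩, ⟨P, hPZ, h⟩, ⟨Q, hQZ, h⟩]

/-- A triangle that is not equilateral contains, after cutting off the corner opposite to a
shortest side, a smaller convex body of the same thickness. -/
lemma not_isReduced (h : vol A B C ≠ 0) (hr : ch B C ≤ ch A B) (hp : ch A B ≤ ch A C)
    (hlt : ch B C < ch A C) : ¬IsReduced (tri A B C) := by
  rintro ⟨-, hred⟩
  obtain ⟨κ, hκ⟩ := exists_smallCut (one_lt_ch_of_vol h) hr hp hlt
  have hκ0 := hκ.pos
  have hbody : IsConvexBody (cutTri A B C κ) := isConvexBody_tri_inter h (by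
    rw [mink_cutNormal_left h, mink_cutNormal_mid h, mink_cutNormal_right h]
    linarith [hκ.le_one])
  have hsub : cutTri A B C κ ⊂ tri A B C := by
    refine ⟨Set.inter_subset_left, fun hsub => ?_⟩
    have hA : 0 ≤ mink A.vec (cutNormal A B C κ) := (hsub (left_mem_tri A B C)).2
    rw [mink_cutNormal_left h] at hA
    linarith
  have h1 := hred _ hbody hsub
  have h2 := le_thickness_cutTri h hr hp hκ
  have h3 := thickness_tri_le (vol_ne_zero_rotate h)
  rw [tri_rotate] at h3
  linarith

lemma vol_ne_zero_swap (h : vol A B C ≠ 0) : vol A C B ≠ 0 := by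
  rw [vol_swap]
  exact neg_ne_zero.2 h

/-- `not_isReduced` applies after relabelling so that `BC` is a shortest side and `AC` a longest
one. -/
lemma ch_eq_of_isReduced (h : vol A B C ≠ 0) (hred : IsReduced (tri A B C)) :
    ch A B = ch B C ∧ ch A C = ch B C := by
  have key : ∀ X Y Z : Plane, vol X Y Z ≠ 0 → IsReduced (tri X Y Z) → ch Y Z ≤ ch X Y →
      ch Y Z ≤ ch X Z → ch X Y = ch Y Z ∧ ch X Z = ch Y Z := by
    have aux : ∀ X Y Z : Plane, vol X Y Z ≠ 0 → IsReduced (tri X Y Z) → ch Y Z ≤ ch X Y →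
        ch X Y ≤ ch X Z → ch X Y = ch Y Z ∧ ch X Z = ch Y Z := by
      intro X Y Z hv hred h1 h2
      have h3 : ch X Z ≤ ch Y Z := by
        by_contra! hlt
        exact not_isReduced hv h1 h2 hlt hred
      exact ⟨by linarith, by linarith⟩
    intro X Y Z hv hred h1 h2
    rcases le_total (ch X Y) (ch X Z) with h3 | h3
    · exact aux X Y Z hv hred h1 h3
    · have := aux X Z Y (vol_ne_zero_swap hv) (by rwa [tri_swap]) (by rwa [ch_comm Z Y]) h3
      rw [ch_comm Z Y] at this
      exact this.symm
  have hv1 := vol_ne_zero_rotate h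
  have hv2 := vol_ne_zero_rotate hv1
  have hred1 : IsReduced (tri B C A) := by rwa [tri_rotate]
  have hred2 : IsReduced (tri C A B) := by rwa [tri_rotate]
  rcases le_total (ch B C) (ch A B) with h1 | h1 <;> rcases le_total (ch B C) (ch A C) with h2 | h2
  · exact key A B C h hred h1 h2
  · obtain ⟨e1, e2⟩ := key B C A hv1 hred1 (by rwa [ch_comm C A])
      (by rw [ch_comm C A, ch_comm B A]; linarith)
    rw [ch_comm C A] at e1 e2
    rw [ch_comm B A] at e2
    exact ⟨by linarith, by linarith⟩
  · obtain ⟨e1, e2⟩ := key C A B hv2 hred2 (by rw [ch_comm C A]; linarith) (by rwa [ch_comm C B])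
    rw [ch_comm C A] at e1
    rw [ch_comm C B] at e2
    exact ⟨by linarith, by linarith⟩
  · rcases le_total (ch A B) (ch A C) with h3 | h3
    · obtain ⟨e1, e2⟩ := key C A B hv2 hred2 (by rwa [ch_comm C A]) (by rwa [ch_comm C B])
      rw [ch_comm C A] at e1
      rw [ch_comm C B] at e2
      exact ⟨by linarith, by linarith⟩
    · obtain ⟨e1, e2⟩ := key B C A hv1 hred1 (by rwa [ch_comm C A])
        (by rwa [ch_comm C A, ch_comm B A])
      rw [ch_comm C A] at e1 e2
      rw [ch_comm B A] at e2
      exact ⟨by linarith, by linarith⟩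

/-! ### Regular polygons with three vertices -/

lemma hdist_eq_iff {X Y Z W : Plane} : hdist X Y = hdist Z W ↔ ch X Y = ch Z W :=
  ⟨fun h => Real.arcosh_injOn (one_le_ch X Y) (one_le_ch Z W) h, fun h => congrArg Real.arcosh h⟩

/-- With `c = ch B C`, the Gram determinant factors: `vol² = (c - 1)² (2 c + 1)`. -/
lemma vol_ne_zero_of_equilateral (hBC : B ≠ C) (h1 : ch A B = ch B C) (h2 : ch A C = ch B C) :
    vol A B C ≠ 0 := by
  intro h
  have hv := vol_sq A B C
  have := one_lt_ch hBC
  rw [h, h1, h2] at hv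
  have e : 0 < (ch B C - 1) ^ 2 * (2 * ch B C + 1) :=
    mul_pos (pow_pos (by linarith) 2) (by linarith)
  linarith

/-- By symmetry the normalized sum of the vertices is equidistant from them. -/
lemma exists_circumcenter (h1 : ch A B = ch B C) (h2 : ch A C = ch B C) :
    ∃ o : Plane, hdist o B = hdist o A ∧ hdist o C = hdist o A := by
  obtain ⟨P, hP, -⟩ := exists_plane_comb A B C zero_le_one zero_le_one zero_le_one (by norm_num)
  have hPX : ∀ X : Plane, ch P X = _ * (ch A X + ch B X + ch C X) := fun X => by
    rw [ch, hP, mink_smul_left, mink_comb_left, mink_eq_neg_ch, mink_eq_neg_ch, mink_eq_neg_ch,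
      ← mul_neg]
    congr 1
    ring
  have hself : ∀ X : Plane, ch X X = 1 := fun X => by rw [ch, X.mink_self, neg_neg]
  refine ⟨P, hdist_eq_iff.2 ?_, hdist_eq_iff.2 ?_⟩
  · rw [hPX, hPX, hself, hself, ch_comm C B, ch_comm B A, ch_comm C A, h1, h2]
    ring
  · rw [hPX, hPX, hself, hself, ch_comm B A, ch_comm C A, h1, h2]
    ring

end

lemma isRegularPolygon_three_of_equilateral {v : Fin 3 → Plane} (h : vol (v 0) (v 1) (v 2) ≠ 0)
    (h1 : ch (v 0) (v 1) = ch (v 1) (v 2)) (h2 : ch (v 0) (v 2) = ch (v 1) (v 2)) :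
    IsRegularPolygon 3 (hull (Set.range v)) := by
  have hr := one_lt_ch_of_vol h
  have hne : ∀ {X Y : Plane}, 1 < ch X Y → X ≠ Y := by
    rintro X _ hXY rfl
    rw [ch, X.mink_self] at hXY
    norm_num at hXY
  have h01 : v 0 ≠ v 1 := hne (by rw [h1]; exact hr)
  have h02 : v 0 ≠ v 2 := hne (by rw [h2]; exact hr)
  have h12 : v 1 ≠ v 2 := hne hr
  obtain ⟨o, ho1, ho2⟩ := exists_circumcenter h1 h2
  refine ⟨le_rfl, v, ?_, ⟨o, hdist o (v 0), ?_⟩, ?_, rfl⟩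
  · intro i j hij
    fin_cases i <;> fin_cases j <;> first
      | rfl
      | exact absurd hij ‹_›
      | exact absurd hij.symm ‹_›
  · intro i
    fin_cases i
    exacts [rfl, ho1, ho2]
  · have key : ∀ i, hdist (v i) (v (finRotate 3 i)) = hdist (v 1) (v 2) := by
      intro i
      rw [hdist_eq_iff]
      fin_cases i
      · exact h1
      · rfl
      · exact (ch_comm _ _).trans h2
    intro i j
    rw [key i, key j]

lemma vol_ne_zero_of_notMem_hull {v : Fin 3 → Plane}
    (hv : ∀ i, v i ∉ hull (v '' {j | j ≠ i})) : vol (v 0) (v 1) (v 2) ≠ 0 := by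
  have key : ∀ i j k : Fin 3, j ≠ i → k ≠ i → v i ∉ hsegment (v j) (v k) := fun i j k hj hk hm =>
    hv i (isConvex_hull _ (v j) (subset_hull _ (Set.mem_image_of_mem v hj)) (v k)
      (subset_hull _ (Set.mem_image_of_mem v hk)) hm)
  exact vol_ne_zero (key 0 1 2 (by decide) (by decide)) (key 1 2 0 (by decide) (by decide))
    (key 2 0 1 (by decide) (by decide))

end Hyperbolic
end

theorem corollary2 (T : Set Hyperbolic.Plane) (hT : Hyperbolic.IsConvexPolygon 3 T) :
    Hyperbolic.IsReduced T ↔ Hyperbolic.IsRegularPolygon 3 T := by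
  constructor
  · intro hred
    obtain ⟨-, v, hv, rfl⟩ := hT
    have hvol := Hyperbolic.vol_ne_zero_of_notMem_hull hv
    rw [Hyperbolic.hull_range_eq_tri] at hred
    obtain ⟨h1, h2⟩ := Hyperbolic.ch_eq_of_isReduced hvol hred
    exact Hyperbolic.isRegularPolygon_three_of_equilateral hvol h1 h2
  · rintro ⟨-, v, hinj, -, hdist, rfl⟩
    have h1 : Hyperbolic.ch (v 0) (v 1) = Hyperbolic.ch (v 1) (v 2) :=
      Hyperbolic.hdist_eq_iff.1 (hdist 0 1)
    have h2 : Hyperbolic.ch (v 0) (v 2) = Hyperbolic.ch (v 1) (v 2) :=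
      -- Index `2` rotates to `0`, so this is the closing side of the polygon.
      (Hyperbolic.ch_comm _ _).trans (Hyperbolic.hdist_eq_iff.1 (hdist 2 1))
    rw [Hyperbolic.hull_range_eq_tri]
    exact Hyperbolic.isReduced_equilateral (Hyperbolic.vol_ne_zero_of_equilateral
      (hinj.ne (by decide)) h1 h2) h1 h2
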